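/- A parity automaton is a tuple $\mathcal{A}=(V,\Sigma,\delta,u_0,\alpha)$ with a set $V$ of states, an alphabet $\Sigma$, a transition relation $\delta\subseteq V\times\Sigma\times V$, an initial state $u_0\in V$ and a priority function $\alpha:\delta\to\mathbb{N}$ on transitions. A run of $\mathcal{A}$ on an infinite word $w=w(0)w(1)\ldots\in\Sigma^\omega$ is an infinite sequence $\rho$ of states with $\rho(0)=u_0$ and $\mathsf{trans}(\rho)(j):=(\rho(j),w(j),\rho(j+1))\in\delta$ for all $j\ge 0$. It is accepting if the highest priority $l$ that occurs infinitely often in the sequence $\alpha(\mathsf{trans}(\rho)(0)),\alpha(\mathsf{trans}(\rho)(1)),\ldots$ exists and is even. The automaton $\mathcal{A}$ is limit-deterministic if for every $w\in\Sigma^\omega$ and every accepting run $\rho$ of $\mathcal{A}$ on $w$ there is $i$ such that for all $j\ge i$, $$\{(\rho(j),w(j),u)\in\delta \mid u\in V,\ \alpha(\rho(j),w(j),u)\le l\}=\{\mathsf{trans}(\rho)(j)\},$$ where $l$ is the highest priority that occurs infinitely often in $\rho$. Corollary. It is decidable in polynomial time whether a given finite parity automaton is limit-deterministic. That is, there is a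 deterministic multi-stack Turing machine which, given any finite parity automaton with $V=\{0,\ldots,n-1\}$ and $\Sigma=\{0,\ldots,m-1\}$, written as the list of the numbers $n$, $m$, $u_0$, followed by $v,a,u,\alpha(v,a,u)$ for each transition $(v,a,u)\in\delta$ (each transition once, in any order, all numbers in binary), outputs whether the automaton is limit-deterministic, within a number of steps that is bounded by a polynomial in the length of the input. -/

import Mathlib

/-- A parity automaton with states `V` and alphabet `S`: a transition relation `δ ⊆ V × S × V`,
an initial state, and a function assigning a priority to every *transition*. -/
structure ParityAutomaton (V S : Type*) where
  /-- transition relation -/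
  δ : Set (V × S × V)
  /-- initial state -/
  u₀ : V
  /-- priority function -/
  α : δ → ℕ

/-- The set of elements that occur infinitely often in a sequence. -/
def infOften {X : Type*} (s : ℕ → X) : Set X :=
  {x | ∃ᶠ i in Filter.atTop, s i = x}

namespace ParityAutomaton

variable {V S : Type*}

/-- The set `δ(v, a)` of `a`-successors of `v`. -/
def succ (A : ParityAutomaton V S) (v : V) (a : S) : Set V :=
  {u | (v, a, u) ∈ A.δ}

/-- The set `δ|_{v,a}` of transitions that leave `v` under the letter `a`. -/
def transFrom (A : ParityAutomaton V S) (v : V) (a : S) : Set (V × S × V) :=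
  {t | ∃ u ∈ A.succ v a, t = (v, a, u)}

/-- The set `α_≤(l)` of transitions with priority at most `l`. -/
def priorityLE (A : ParityAutomaton V S) (l : ℕ) : Set (V × S × V) :=
  {t | ∃ h : t ∈ A.δ, A.α ⟨t, h⟩ ≤ l}

/-- The (infinite) runs of `A` on the infinite word `w` starting at `v`. -/
structure Run (A : ParityAutomaton V S) (v : V) (w : ℕ → S) where
  /-- the sequence of states of the run -/
  state : ℕ → V
  state_zero : state 0 = v
  state_succ : ∀ i, state (i + 1) ∈ A.succ (state i) (w i)

namespace Run

variable {A : ParityAutomaton V S} {v : V} {w : ℕ → S}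

/-- The sequence of transitions of a run. -/
def trans (ρ : A.Run v w) (i : ℕ) : A.δ :=
  ⟨(ρ.state i, w i, ρ.state (i + 1)), ρ.state_succ i⟩

/-- `l` is the highest priority that occurs infinitely often in the run. -/
def IsMaxInf (ρ : A.Run v w) (l : ℕ) : Prop :=
  IsGreatest (infOften (A.α ∘ ρ.trans)) l

/-- A run is accepting if the highest priority that occurs infinitely often in it is even. -/
def IsAccepting (ρ : A.Run v w) : Prop :=
  ∃ l, ρ.IsMaxInf l ∧ Even l

end Run

/-- Every accepting run from the initial state eventually uses, at each position, the only
transition that is available for the current state and letter among those with priority at most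
the highest priority `l` occurring infinitely often in the run. -/
def LimitDeterministic (A : ParityAutomaton V S) : Prop :=
  ∀ (w : ℕ → S) (ρ : A.Run A.u₀ w), ρ.IsAccepting → ∀ l, ρ.IsMaxInf l →
    ∃ i, ∀ j ≥ i, A.transFrom (ρ.state j) (w j) ∩ A.priorityLE l = {(ρ.trans j : V × S × V)}

end ParityAutomaton

/-- A finite parity automaton given explicitly: the states and the letters are numbered
`0, …, n - 1` and `0, …, m - 1`, and the transitions are listed without repetition, in any
order. -/
structure PresentedParityAutomaton where
  /-- number of states -/
  n : ℕ
  /-- number of letters -/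
  m : ℕ
  /-- the automaton itself -/
  toAutomaton : ParityAutomaton (Fin n) (Fin m)
  /-- the list of its transitions -/
  transitions : List toAutomaton.δ
  nodup : transitions.Nodup
  complete : ∀ t, t ∈ transitions

/-- A list of natural numbers as a word: each number in binary (least significant bit first),
followed by a comma. -/
def encodeNumbers (l : List ℕ) : List Computability.Γ' :=
  l.flatMap fun x =>
    (Computability.encodeNat x).map Computability.Γ'.bit ++ [Computability.Γ'.comma]

namespace PresentedParityAutomaton

/-- The numbers written on the input tape: the number of states, the number of letters, the initial
state, and for each transition its source, letter, target and priority. -/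
def numbers (P : PresentedParityAutomaton) : List ℕ :=
  [P.n, P.m, (P.toAutomaton.u₀ : ℕ)] ++
    P.transitions.flatMap fun t =>
      [(t.1.1 : ℕ), (t.1.2.1 : ℕ), (t.1.2.2 : ℕ), P.toAutomaton.α t]

/-- The input word that represents a finite parity automaton. -/
def encode (P : PresentedParityAutomaton) : List Computability.Γ' :=
  encodeNumbers P.numbers

end PresentedParityAutomaton

/-- A property of the elements of `X` is decidable in polynomial time with respect to the encoding
`enc` of these elements as words if some (multi-stack) Turing machine outputs, on every input
`enc x`, the truth value of `p x` within a number of steps that is polynomial in the length of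
`enc x`. -/
def DecidableInPolyTime {X Γ : Type} (enc : X → List Γ) (p : X → Prop) : Prop :=
  ∃ f : X → Bool, (∀ x, f x = true ↔ p x) ∧
    Nonempty (Turing.TM2ComputableInPolyTime enc Computability.encodeBool f)

/-! With finitely many transitions, limit-determinism fails exactly when there are transitions t₁,
t₂ with the same source and letter but different targets, and a transition t₃ of even priority l,
such that t₁ and t₂ have priority at most l, the source of t₁ is reachable, and t₁ and t₃ lie on a
closed walk with priorities at most l (`ParityAutomaton.limitDeterministic_iff`). Repeating this
walk forever gives an accepting run that meets the alternative t₂ infinitely often. Conversely, if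
an accepting run has infinitely many bad positions, then by pigeonhole one transition is taken at
infinitely many of them; far enough along, the run between two such positions can be chosen to
contain l and never exceeds it.

There are cubically many triples, and each requires three reachability tests, done by saturation
(`exists_mem_reach`).

To get an actual machine, the test is written as a function on lists of binary numbers. The
functions computed in polynomial time by structured stack programs (`PolyTime`) are closed under
composition, pairing, case distinction and folds with controlled growth (`PolyTime.foldl`), so that
`fun_prop` bounds the time of the whole test. `Prog.Exec.iterate_step` compiles programs into Turing
machines without any loss of time. -/

/-- The stacks on which programs work: the data stack and two auxiliary stacks. -/
inductive Stk
  | main | aux₁ | aux₂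
  deriving DecidableEq

namespace Stk

instance : Fintype Stk := ⟨{main, aux₁, aux₂}, fun k => by cases k <;> simp⟩

/-- The memory of a program: the symbol read last and the contents of the three stacks. -/
structure Mem where
  /-- the symbol read last, if any -/
  var : Option Computability.Γ'
  /-- the data stack -/
  main : List Computability.Γ'
  /-- the first auxiliary stack -/
  aux₁ : List Computability.Γ'
  /-- the second auxiliary stack -/
  aux₂ : List Computability.Γ'

namespace Mem

/-- The contents of a stack. -/
def get (s : Mem) : Stk → List Computability.Γ'
  | Stk.main => s.main
  | Stk.aux₁ => s.aux₁
  | Stk.aux₂ => s.aux₂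

/-- Pop a symbol from a stack into the variable. -/
def pop : Stk → Mem → Mem
  | Stk.main, ⟨_, a, b, c⟩ => ⟨a.head?, a.tail, b, c⟩
  | Stk.aux₁, ⟨_, a, b, c⟩ => ⟨b.head?, a, b.tail, c⟩
  | Stk.aux₂, ⟨_, a, b, c⟩ => ⟨c.head?, a, b, c.tail⟩

/-- Push a symbol on a stack. -/
def push (x : Computability.Γ') : Stk → Mem → Mem
  | Stk.main, ⟨v, a, b, c⟩ => ⟨v, x :: a, b, c⟩
  | Stk.aux₁, ⟨v, a, b, c⟩ => ⟨v, a, x :: b, c⟩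
  | Stk.aux₂, ⟨v, a, b, c⟩ => ⟨v, a, b, x :: c⟩

/-- The number of symbols on the stacks. -/
def size (s : Mem) : ℕ := s.main.length + s.aux₁.length + s.aux₂.length

end Mem

end Stk

/-! ### Structured programs and their compilation into Turing machines -/

open Stk (Mem)

/-- Structured programs for a machine with three stacks. -/
inductive Prog
  | pop (k : Stk)
  | push (k : Stk) (g : Option Computability.Γ' → Computability.Γ')
  | seq (p q : Prog)
  | ite (b : Option Computability.Γ' → Bool) (p q : Prog)
  | loop (b : Option Computability.Γ' → Bool) (p : Prog)

namespace Prog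

/-- `Exec p s s' t`: the program `p` started in memory `s` ends in memory `s'` after `t` steps. -/
inductive Exec : Prog → Mem → Mem → ℕ → Prop
  | pop (k s) : Exec (.pop k) s (s.pop k) 1
  | push (k g s) : Exec (.push k g) s (s.push (g s.var) k) 1
  | seq {p q s s' s'' t t'} : Exec p s s' t → Exec q s' s'' t' → Exec (.seq p q) s s'' (t + t')
  | ite_true {b p q s s' t} : b s.var = true → Exec p s s' t → Exec (.ite b p q) s s' (t + 1)
  | ite_false {b p q s s' t} : b s.var = false → Exec q s s' t → Exec (.ite b p q) s s' (t + 1)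
  | loop_false {b p s} : b s.var = false → Exec (.loop b p) s s 1
  | loop_true {b p s s' s'' t t'} : b s.var = true → Exec p s s' t → Exec (.loop b p) s' s'' t' →
      Exec (.loop b p) s s'' (t' + (t + 1))

/-- A step pushes at most one symbol. Hence a time bound also bounds the size of the result, which
is what makes composition work. -/
theorem Exec.size_le {p s s' t} (h : Exec p s s' t) : s'.size ≤ s.size + t := by
  induction h with
  | pop k s => cases k <;> simp [Stk.Mem.pop, Stk.Mem.size] <;> omega
  | push k g s => cases k <;> simp [Stk.Mem.push, Stk.Mem.size] <;> omega
  | _ => omega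

/-- The program points of a program. -/
def Label : Prog → Type
  | pop _ => Unit
  | push _ _ => Unit
  | seq p q => p.Label ⊕ q.Label
  | ite _ p q => Option (p.Label ⊕ q.Label)
  | loop _ p => Option p.Label

/-- A program has finitely many program points. -/
instance fintypeLabel : (p : Prog) → Fintype p.Label
  | pop _ => inferInstanceAs (Fintype Unit)
  | push _ _ => inferInstanceAs (Fintype Unit)
  | seq p q =>
    letI := p.fintypeLabel; letI := q.fintypeLabel
    inferInstanceAs (Fintype (p.Label ⊕ q.Label))
  | ite _ p q =>
    letI := p.fintypeLabel; letI := q.fintypeLabel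
    inferInstanceAs (Fintype (Option (p.Label ⊕ q.Label)))
  | loop _ p =>
    letI := p.fintypeLabel
    inferInstanceAs (Fintype (Option p.Label))

/-- The program point at which the execution of a program begins. -/
def entry : (p : Prog) → p.Label
  | pop _ => ()
  | push _ _ => ()
  | seq p _ => .inl p.entry
  | ite _ _ _ => none
  | loop _ _ => none

/-- The stack alphabets of the machine: there is one stack for the output. -/
def Alphabet : Option Stk → Type
  | none => Bool
  | some _ => Computability.Γ'

/-- The machine statements at the program points of a program that is embedded by `emb` in a larger
machine, which continues at `exit` once the program has ended. -/
def code : (p : Prog) → {L : Type} → (emb : p.Label → L) → (exit : L) → p.Label →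
    Turing.TM2.Stmt Alphabet L (Option Computability.Γ')
  | pop k, _, _, exit, _ => .pop (some k) (fun _ o => o) (.goto fun _ => exit)
  | push k g, _, _, exit, _ => .push (some k) g (.goto fun _ => exit)
  | seq p q, _, emb, _, .inl l => p.code (emb ∘ .inl) (emb (.inr q.entry)) l
  | seq _ q, _, emb, exit, .inr l => q.code (emb ∘ .inr) exit l
  | ite b p q, _, emb, _, none =>
    .branch b (.goto fun _ => emb (some (.inl p.entry))) (.goto fun _ => emb (some (.inr q.entry)))
  | ite _ p _, _, emb, exit, some (.inl l) => p.code (emb ∘ some ∘ .inl) exit l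
  | ite _ _ q, _, emb, exit, some (.inr l) => q.code (emb ∘ some ∘ .inr) exit l
  | loop b p, _, emb, exit, none =>
    .branch b (.goto fun _ => emb (some p.entry)) (.goto fun _ => exit)
  | loop _ p, _, emb, _, some l => p.code (emb ∘ some) (emb none) l

/-- The machine configuration at a label for a given memory, with an empty output stack. -/
def config {L : Type} (l : L) (s : Mem) : Turing.TM2.Cfg Alphabet L (Option Computability.Γ') where
  l := some l
  var := s.var
  stk
    | none => []
    | some k => s.get k

open Turing Function in
-- The ambient machine `M`, the embedding and the exit are arbitrary because a subprogram sits
-- inside a larger machine; all that matters is that `M` carries the right code on the image of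
-- `emb`. Each program point costs one machine step, so the count is exact.
theorem Exec.iterate_step {p s s' t} (h : Exec p s s' t) {L : Type} (emb : p.Label → L) (exit : L)
    (M : L → TM2.Stmt Alphabet L (Option Computability.Γ'))
    (hM : ∀ l, M (emb l) = p.code emb exit l) :
    (flip bind (TM2.step M))^[t] (some (config (emb p.entry) s)) = some (config exit s') := by
  induction h generalizing L exit with
  | pop k s =>
    have := hM ()
    simp only [entry, iterate_one, flip, Option.bind_eq_bind, Option.bind_some, config, TM2.step,
      this, code, TM2.stepAux]
    congr 1
    congr 1
    · cases k <;> rfl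
    · funext i
      rcases i with _ | i
      · rfl
      · cases k <;> cases i <;> rfl
  | push k g s =>
    have := hM ()
    simp only [entry, iterate_one, flip, Option.bind_eq_bind, Option.bind_some, config, TM2.step,
      this, code, TM2.stepAux]
    congr 1
    congr 1
    · cases k <;> rfl
    · funext i
      rcases i with _ | i
      · rfl
      · cases k <;> cases i <;> rfl
  | @seq p q s s' s'' t t' _ _ ih₁ ih₂ =>
    rw [add_comm, iterate_add_apply]
    have h₁ := ih₁ (emb ∘ .inl) (emb (.inr q.entry)) M fun l => hM (.inl l)
    have h₂ := ih₂ (emb ∘ .inr) exit M fun l => hM (.inr l)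
    exact (congrArg _ h₁).trans h₂
  | @ite_true b p q s s' t hb _ ih =>
    rw [iterate_add_apply]
    have h₁ := ih (emb ∘ some ∘ .inl) exit M fun l => hM (some (.inl l))
    refine Eq.trans (congrArg _ ?_) h₁
    have := hM none
    simp only [entry, iterate_one, flip, Option.bind_eq_bind, Option.bind_some, config, TM2.step,
      this, code, TM2.stepAux, hb]
    rfl
  | @ite_false b p q s s' t hb _ ih =>
    rw [iterate_add_apply]
    have h₁ := ih (emb ∘ some ∘ .inr) exit M fun l => hM (some (.inr l))
    refine Eq.trans (congrArg _ ?_) h₁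
    have := hM none
    simp only [entry, iterate_one, flip, Option.bind_eq_bind, Option.bind_some, config, TM2.step,
      this, code, TM2.stepAux, hb]
    rfl
  | @loop_false b p s hb =>
    have := hM none
    simp only [entry, iterate_one, flip, Option.bind_eq_bind, Option.bind_some, config, TM2.step,
      this, code, TM2.stepAux, hb]
    rfl
  | @loop_true b p s s' s'' t t' hb _ _ ih₁ ih₂ =>
    rw [iterate_add_apply, iterate_add_apply]
    have h₁ := ih₁ (emb ∘ some) (emb none) M fun l => hM (some l)
    have h₂ := ih₂ emb exit M hM
    refine Eq.trans (congrArg _ (Eq.trans (congrArg _ ?_) h₁)) h₂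
    have := hM none
    simp only [entry, iterate_one, flip, Option.bind_eq_bind, Option.bind_some, config, TM2.step,
      this, code, TM2.stepAux, hb]
    rfl

/-- The machine that runs a program on its input and outputs the bit read last. -/
def machine (p : Prog) : Turing.FinTM2 where
  K := Option Stk
  k₀ := some .main
  k₁ := none
  Γ := Alphabet
  Λ := Option p.Label
  main := some p.entry
  σ := Option Computability.Γ'
  initialState := none
  Γk₀Fin := inferInstanceAs (Fintype Computability.Γ')
  m
    | some l => p.code some none l
    | none => .push none (fun v => decide (v = some (.bit true))) (.load (fun _ => none) .halt)

open Turing in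
-- The program must leave its three stacks empty since a halting configuration has only the output.
-- The extra step writes the bit and resets the variable to its initial value.
theorem exists_outputsInTime {p : Prog} {w b t n}
    (h : Exec p ⟨none, w, [], []⟩ ⟨some (.bit b), [], [], []⟩ t) (hn : t + 1 ≤ n) :
    Nonempty (TM2OutputsInTime p.machine w (some [b]) n) := by
  refine ⟨⟨⟨1 + t, ?_⟩, (add_comm 1 t).trans_le hn⟩⟩
  have key := h.iterate_step some none p.machine.m fun _ => rfl
  have hin : initList p.machine w = config (some p.entry) ⟨none, w, [], []⟩ := by
    unfold initList config
    congr 1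
    funext k
    rcases k with _ | k
    · rfl
    · cases k <;> rfl
  rw [hin, Function.iterate_add_apply]
  refine (congrArg _ key).trans ?_
  simp only [Function.iterate_one, flip, Option.bind_eq_bind, config,
    FinTM2.step, Option.map_some, haltList]
  refine congrArg some ?_
  simp only [machine, TM2.stepAux]
  congr 1
  funext k
  rcases k with _ | k
  · cases b <;> rfl
  · cases k <;> rfl

end Prog

/-! ### Time bounds and transfer of words between stacks -/

open Computability (Γ')

namespace Prog

/-- The program `p` leads from memory `s` to memory `s'`, up to the variable, in at most `n`
steps. -/
def Runs (p : Prog) (s : Mem) (a b c : List Γ') (n : ℕ) : Prop :=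
  ∃ v t, Exec p s ⟨v, a, b, c⟩ t ∧ t ≤ n

theorem Runs.mono {p s a b c n n'} (h : Runs p s a b c n) (hn : n ≤ n') : Runs p s a b c n' := by
  obtain ⟨v, t, h, ht⟩ := h
  exact ⟨v, t, h, ht.trans hn⟩

theorem Exec.runs {p s v a b c t} (h : Exec p s ⟨v, a, b, c⟩ t) : Runs p s a b c t :=
  ⟨v, t, h, le_rfl⟩

theorem Runs.seq {p q s a b c a' b' c' n n'} (h : Runs p s a b c n)
    (h' : ∀ v, Runs q ⟨v, a, b, c⟩ a' b' c' n') : Runs (.seq p q) s a' b' c' (n + n') := by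
  obtain ⟨v, t, h, ht⟩ := h
  obtain ⟨v', t', h', ht'⟩ := h' v
  exact ⟨v', t + t', h.seq h', add_le_add ht ht'⟩

theorem Exec.seq_runs {p q s s' a b c t n} (h : Exec p s s' t) (h' : Runs q s' a b c n) :
    Runs (.seq p q) s a b c (t + n) := by
  obtain ⟨v', t', h', ht'⟩ := h'
  exact ⟨v', t + t', h.seq h', by omega⟩

/-- Pop symbols from the stack `i`, run `p` after each of them, and stop at a blank. -/
def untilBlank (i : Stk) (p : Prog) : Prog :=
  .seq (.pop i) (.loop (fun v => decide (v ≠ some .blank)) (.seq p (.pop i)))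

/-- Here `m v x w` is the memory with variable `v`, words `x` collected so far and contents `w` of
the stack `i`. Each symbol costs the body, a loop test and a pop; the first pop and the final test
give the remaining 2. -/
theorem exec_untilBlank {i : Stk} {p : Prog} {k : ℕ} (m : Option Γ' → List Γ' → List Γ' → Mem)
    (hvar : ∀ v x w, (m v x w).var = v) (hpop : ∀ v x w, (m v x w).pop i = m w.head? x w.tail)
    (hp : ∀ g x w, Exec p (m (some g) x w) (m (some g) (g :: x) w) k)
    {w : List Γ'} (hw : Γ'.blank ∉ w) (v x b) :
    Exec (untilBlank i p) (m v x (w ++ .blank :: b)) (m (some .blank) (w.reverse ++ x) b)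
      ((k + 2) * w.length + 2) := by
  have key : ∀ w : List Γ', Γ'.blank ∉ w → ∀ x,
      Exec (.loop (fun v => decide (v ≠ some .blank)) (.seq p (.pop i)))
        (m (w ++ .blank :: b).head? x (w ++ .blank :: b).tail)
        (m (some .blank) (w.reverse ++ x) b) ((k + 2) * w.length + 1) := by
    intro w
    induction w with
    | nil => exact fun _ x => Exec.loop_false (by simp [hvar])
    | cons g w ih =>
      intro hw x
      rw [List.mem_cons, not_or] at hw
      have h₁ := (hp g x (w ++ .blank :: b)).seq (Exec.pop i _)
      rw [hpop] at h₁
      have h₂ := Exec.loop_true (b := fun v => decide (v ≠ some .blank))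
        (by simp [hvar, Ne.symm hw.1]) h₁ (ih hw.2 (g :: x))
      have ht : (k + 2) * (g :: w).length + 1 = (k + 2) * w.length + 1 + (k + 1 + 1) := by
        rw [List.length_cons]; ring
      rw [ht, List.reverse_cons, List.append_assoc]
      exact h₂
  have h := Exec.pop i (m v x (w ++ .blank :: b))
  rw [hpop] at h
  exact add_comm 1 _ ▸ h.seq (key w hw x)

/-- Move the symbols above the topmost blank from the stack `i` to the stack `j`, and remove this
blank. -/
def move (i j : Stk) : Prog := untilBlank i (.push j fun v => v.getD .blank)

theorem exec_move_aux₁_main {w : List Γ'} (hw : Γ'.blank ∉ w) (v a b c) :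
    Exec (move .aux₁ .main) ⟨v, a, w ++ .blank :: b, c⟩ ⟨some .blank, w.reverse ++ a, b, c⟩
      (3 * w.length + 2) :=
  exec_untilBlank (fun v x w => ⟨v, x, w, c⟩) (fun _ _ _ => rfl) (fun _ _ _ => rfl)
    (fun _ _ _ => Exec.push _ _ _) hw v a b

theorem exec_move_aux₁_aux₂ {w : List Γ'} (hw : Γ'.blank ∉ w) (v a b c) :
    Exec (move .aux₁ .aux₂) ⟨v, a, w ++ .blank :: b, c⟩ ⟨some .blank, a, b, w.reverse ++ c⟩
      (3 * w.length + 2) :=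
  exec_untilBlank (fun v x w => ⟨v, a, w, x⟩) (fun _ _ _ => rfl) (fun _ _ _ => rfl)
    (fun _ _ _ => Exec.push _ _ _) hw v c b

theorem exec_move_aux₂_aux₁ {w : List Γ'} (hw : Γ'.blank ∉ w) (v a b c) :
    Exec (move .aux₂ .aux₁) ⟨v, a, b, w ++ .blank :: c⟩ ⟨some .blank, a, w.reverse ++ b, c⟩
      (3 * w.length + 2) :=
  exec_untilBlank (fun v x w => ⟨v, a, x, w⟩) (fun _ _ _ => rfl) (fun _ _ _ => rfl)
    (fun _ _ _ => Exec.push _ _ _) hw v b c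

end Prog

/-! ### Self-delimiting encodings of data -/

/-- Data types whose elements are written on the data stack as words without blanks, together with
a program that recognizes the end of such a word. -/
class Enc (α : Type) where
  /-- the word that represents an element -/
  enc : α → List Γ'
  blank_notMem (x) : Γ'.blank ∉ enc x
  /-- a program that moves the word on top of the data stack to the first auxiliary stack -/
  unload : Prog
  /-- a factor in the running time of this program -/
  factor : ℕ
  runs_unload (x v r b c) :
    unload.Runs ⟨v, enc x ++ r, b, c⟩ r ((enc x).reverse ++ b) c (factor * (enc x).length)

namespace Enc

/-- The length of the word that represents an element of a data type. -/
def size {α : Type} [Enc α] (x : α) : ℕ := (enc x).length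

instance : Enc Bool where
  enc b := [.bit b]
  blank_notMem := by simp
  unload := .seq (.pop .main) (.push .aux₁ fun v => v.getD .blank)
  factor := 2
  runs_unload x v r b c := ((Prog.Exec.pop _ _).seq (Prog.Exec.push _ _ _)).runs

instance {α β : Type} [Enc α] [Enc β] : Enc (α × β) where
  enc x := enc x.1 ++ enc x.2
  blank_notMem x := by simp [blank_notMem]
  unload := .seq (unload α) (unload β)
  factor := factor α + factor β
  runs_unload x v r b c := by
    have h₁ := runs_unload x.1 v (enc x.2 ++ r) b c
    have h₂ := fun v => runs_unload x.2 v r ((enc x.1).reverse ++ b) c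
    simp only [List.append_assoc, List.reverse_append]
    refine (h₁.seq h₂).mono ?_
    rw [List.length_append]
    nlinarith

/-- The word that represents a list. -/
def encList {α : Type} [Enc α] : List α → List Γ'
  | [] => [.ket]
  | x :: xs => .bra :: (enc x ++ encList xs)

/-- The marker read last tells whether another element follows. Nesting is harmless, because the
markers inside an element are consumed by the program for that element. -/
instance {α : Type} [Enc α] : Enc (List α) where
  enc := encList
  blank_notMem l := by induction l <;> simp_all [encList, blank_notMem]
  unload :=
    let p := .seq (.pop .main) (.push .aux₁ fun v => v.getD .blank)
    .seq p (.loop (fun v => decide (v = some .bra)) (.seq (unload α) p))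
  factor := factor α + 3
  runs_unload l v r b c := by
    have hp : ∀ v x r b, Prog.Exec (.seq (.pop .main) (.push .aux₁ fun v => v.getD .blank))
        ⟨v, x :: r, b, c⟩ ⟨some x, r, x :: b, c⟩ 2 :=
      fun v x r b => (Prog.Exec.pop _ _).seq (Prog.Exec.push _ _ _)
    -- On entry to the loop the first marker has already been moved; `t + 2` accounts for the two
    -- steps of that move.
    have key : ∀ (l : List α) b, ∃ v' t,
        Prog.Exec (.loop (fun v => decide (v = some .bra))
          (.seq (unload α) (.seq (.pop .main) (.push .aux₁ fun v => v.getD .blank))))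
        ⟨(encList l).head?, (encList l).tail ++ r, (encList l).take 1 ++ b, c⟩
        ⟨v', r, (encList l).reverse ++ b, c⟩ t ∧ t + 2 ≤ (factor α + 3) * (encList l).length := by
      intro l
      induction l with
      | nil =>
        intro b
        refine ⟨_, _, Prog.Exec.loop_false rfl, ?_⟩
        simp only [encList, List.length_singleton]
        omega
      | cons x xs ih =>
        intro b
        obtain ⟨v₁, t₁, h₁, ht₁⟩ := runs_unload x (some .bra) (encList xs ++ r) (.bra :: b) c
        obtain ⟨v₂, t₂, h₂, ht₂⟩ := ih ((enc x).reverse ++ .bra :: b)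
        obtain ⟨g, w, hg⟩ : ∃ g w, encList xs = g :: w := by
          cases xs <;> exact ⟨_, _, rfl⟩
        have h₃ := h₁.seq (by rw [hg]; exact hp v₁ g (w ++ r) _)
        rw [hg] at h₂
        have h₄ := Prog.Exec.loop_true (b := fun v => decide (v = some .bra)) rfl h₃ h₂
        refine ⟨v₂, t₂ + (t₁ + 2 + 1), ?_, ?_⟩
        · convert h₄ using 1
          · simp [encList, hg]
          · simp [encList, hg]
        · simp only [encList, List.length_cons, List.length_append]
          nlinarith
    obtain ⟨g, w, hg⟩ : ∃ g w, encList l = g :: w := by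
      cases l <;> exact ⟨_, _, rfl⟩
    obtain ⟨v', t, h, ht⟩ := key l b
    rw [hg] at h ht ⊢
    exact ⟨v', 2 + t, (hp v g (w ++ r) b).seq h, by omega⟩

variable {α β : Type} [Enc α] [Enc β]

theorem enc_cons (x : α) (l : List α) : enc (x :: l) = .bra :: (enc x ++ enc l) := rfl

theorem enc_mk (x : α) (y : β) : enc (x, y) = enc x ++ enc y := rfl

@[simp] theorem size_bool (b : Bool) : size b = 1 := rfl

@[simp] theorem size_nil : size ([] : List α) = 1 := rfl

@[simp] theorem size_cons (x : α) (l : List α) : size (x :: l) = size x + size l + 1 := by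
  simp [size, enc_cons]

@[simp] theorem size_mk (x : α) (y : β) : size (x, y) = size x + size y := by
  simp [size, enc_mk]

theorem size_fst_le (p : α × β) : size p.1 ≤ size p := by
  obtain ⟨x, y⟩ := p; simp

theorem length_lt_size (l : List α) : l.length < size l := by
  induction l with
  | nil => simp
  | cons x l ih => simp; omega

theorem size_append (l l' : List α) : size (l ++ l') + 1 = size l + size l' := by
  induction l with
  | nil => simp; omega
  | cons x l ih => simp; omega

theorem one_le_size_list (l : List α) : 1 ≤ size l := by
  cases l <;> simp

end Enc

/-! ### Closure properties of polynomial time -/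

theorem Polynomial.eval_mono_nat (P : Polynomial ℕ) {m n : ℕ} (h : m ≤ n) :
    P.eval m ≤ P.eval n := by
  rw [Polynomial.eval_eq_sum, Polynomial.eval_eq_sum]
  exact Finset.sum_le_sum fun i _ => Nat.mul_le_mul_left _ (Nat.pow_le_pow_left h i)

open Enc

/-- A function between data types is computable in polynomial time by a program that replaces the
argument on top of the data stack by the value. -/
@[fun_prop]
def PolyTime {α β : Type} [Enc α] [Enc β] (f : α → β) : Prop :=
  ∃ (p : Prog) (P : Polynomial ℕ), ∀ x v r b c,
    p.Runs ⟨v, enc x ++ r, b, c⟩ (enc (f x) ++ r) b c (P.eval (size x))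

namespace PolyTime

variable {α β γ δ : Type} [Enc α] [Enc β] [Enc γ] [Enc δ]

theorem exists_size_le {f : α → β} (hf : PolyTime f) :
    ∃ P : Polynomial ℕ, ∀ x, size (f x) ≤ P.eval (size x) := by
  obtain ⟨p, P, h⟩ := hf
  refine ⟨.X + P, fun x => ?_⟩
  obtain ⟨v, t, h, ht⟩ := h x none [] [] []
  have := h.size_le
  simp only [Stk.Mem.size, List.append_nil, List.length_nil, add_zero] at this
  simp only [Polynomial.eval_add, Polynomial.eval_X]
  exact this.trans (Nat.add_le_add_left ht _)

theorem of_linear {f : α → β} (p : Prog) (k m : ℕ)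
    (h : ∀ x v r b c, p.Runs ⟨v, enc x ++ r, b, c⟩ (enc (f x) ++ r) b c (k * size x + m)) :
    PolyTime f :=
  ⟨p, .C k * .X + .C m, fun x v r b c => (h x v r b c).mono (by simp)⟩

theorem comp {g : β → γ} {f : α → β} (hg : PolyTime g) (hf : PolyTime f) :
    PolyTime fun x => g (f x) := by
  obtain ⟨R, hR⟩ := hf.exists_size_le
  obtain ⟨p, P, hp⟩ := hf
  obtain ⟨q, Q, hq⟩ := hg
  refine ⟨.seq p q, P + Q.comp R, fun x v r b c => ?_⟩
  refine ((hp x v r b c).seq fun v => hq (f x) v r b c).mono ?_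
  simp only [Polynomial.eval_add, Polynomial.eval_comp]
  exact Nat.add_le_add_left (Q.eval_mono_nat (hR x)) _

protected theorem id : PolyTime fun x : α => x :=
  -- There is no empty program; pushing and popping a dummy symbol takes its place.
  of_linear (.seq (.push .aux₁ fun _ => .blank) (.pop .aux₁)) 0 2 fun _ _ _ _ _ =>
    (((Prog.Exec.push _ _ _).seq (Prog.Exec.pop _ _)).runs).mono (by simp)

/-- The same program works, since it never disturbs what lies below its argument. -/
theorem map_fst {f : α → β} (hf : PolyTime f) :
    PolyTime fun x : α × γ => (f x.1, x.2) := by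
  obtain ⟨p, P, hp⟩ := hf
  refine ⟨p, P, fun x v r b c => ?_⟩
  have := hp x.1 v (enc x.2 ++ r) b c
  rw [← List.append_assoc, ← List.append_assoc] at this
  exact this.mono (P.eval_mono_nat (size_fst_le x))

/-- Move the datum on top of the data stack to the first auxiliary stack, above a blank. -/
def save (α : Type) [Enc α] : Prog := .seq (.push .aux₁ fun _ => .blank) (unload α)

theorem runs_save (x : α) (v r b c) : (save α).Runs ⟨v, enc x ++ r, b, c⟩ r
    ((enc x).reverse ++ .blank :: b) c (1 + factor α * size x) :=
  (Prog.Exec.push _ _ _).seq_runs (runs_unload x v r (.blank :: b) c)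

theorem blank_notMem_reverse (x : α) : Γ'.blank ∉ (enc x).reverse := by
  simp [blank_notMem]

theorem runs_restore (x : α) (v r b c) : (Prog.move .aux₁ .main).Runs
    ⟨v, r, (enc x).reverse ++ .blank :: b, c⟩ (enc x ++ r) b c (3 * size x + 2) := by
  have := Prog.exec_move_aux₁_main (blank_notMem_reverse x) v r b c
  rw [List.reverse_reverse, List.length_reverse] at this
  exact this.runs

/-- The first component is parked on the auxiliary stack; the blank beneath it marks where to stop
when it is fetched back. -/
theorem map_snd {f : β → γ} (hf : PolyTime f) :
    PolyTime fun x : α × β => (x.1, f x.2) := by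
  obtain ⟨p, P, hp⟩ := hf
  refine ⟨.seq (save α) (.seq p (.move .aux₁ .main)),
    .C (factor α + 3) * .X + P + .C 3, fun x v r b c => ?_⟩
  obtain ⟨x, y⟩ := x
  simp only [enc_mk, List.append_assoc]
  refine ((runs_save x v (enc y ++ r) b c).seq fun v =>
    (hp y v r _ c).seq fun v => runs_restore x v _ b c).mono ?_
  have := P.eval_mono_nat (m := size y) (n := size (x, y)) (by simp)
  simp only [Polynomial.eval_add, Polynomial.eval_mul, Polynomial.eval_C, Polynomial.eval_X]
  simp only [size_mk] at this ⊢
  nlinarith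

/-- Emptying `aux₁` onto two stacks at once makes the copy. Every transfer reverses a word, so the
copy on `aux₂` passes through `aux₁` before it reaches the data stack. -/
theorem dup : PolyTime fun x : α => (x, x) := by
  refine of_linear (.seq (save α) <| .seq (.push .aux₂ fun _ => .blank) <|
    .seq (Prog.untilBlank .aux₁ (.seq (.push .main fun v => v.getD .blank)
      (.push .aux₂ fun v => v.getD .blank))) <| .seq (.push .aux₁ fun _ => .blank) <|
    .seq (.move .aux₂ .aux₁) (.move .aux₁ .main)) (factor α + 10) 10 fun x v r b c => ?_
  simp only [enc_mk, List.append_assoc]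
  have h : ∀ v, Prog.Runs _ ⟨v, r, (enc x).reverse ++ .blank :: b, .blank :: c⟩
      (enc x ++ r) b (enc x ++ .blank :: c) _ := fun v => by
    have := Prog.exec_untilBlank (k := 2) (i := .aux₁)
      (p := .seq (.push .main fun v => v.getD .blank) (.push .aux₂ fun v => v.getD .blank))
      (fun v x w => ⟨v, x ++ r, w, x ++ .blank :: c⟩) (fun _ _ _ => rfl) (fun _ _ _ => rfl)
      (fun _ _ _ => (Prog.Exec.push _ _ _).seq (Prog.Exec.push _ _ _))
      (blank_notMem_reverse x) v [] b
    rw [List.reverse_reverse, List.append_nil] at this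
    exact this.runs
  refine ((runs_save x v r b c).seq fun v => (Prog.Exec.push _ _ _).seq_runs <|
    (h v).seq fun v => (Prog.Exec.push _ _ _).seq_runs <|
    (Prog.exec_move_aux₂_aux₁ (blank_notMem x) v (enc x ++ r) (.blank :: b) c).runs.seq
    fun v => runs_restore x v _ b c).mono ?_
  rw [List.length_reverse, ← size]
  nlinarith

theorem swap : PolyTime fun x : α × β => (x.2, x.1) := by
  refine of_linear (.seq (save α) <| .seq (.push .aux₂ fun _ => .blank) <|
    .seq (.move .aux₁ .aux₂) <| .seq (save β) <| .seq (.push .aux₁ fun _ => .blank) <|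
    .seq (.move .aux₂ .aux₁) <| .seq (.move .aux₁ .main) (.move .aux₁ .main))
    (factor α + factor β + 12) 20 fun x v r b c => ?_
  obtain ⟨x, y⟩ := x
  simp only [enc_mk, List.append_assoc]
  have h : ∀ v, Prog.Runs (.seq (.move .aux₂ .aux₁) (.seq (.move .aux₁ .main) (.move .aux₁ .main)))
      ⟨v, r, .blank :: ((enc y).reverse ++ .blank :: b), enc x ++ .blank :: c⟩
      (enc y ++ (enc x ++ r)) b c (3 * size x + 2 + (3 * size x + 2 + (3 * size y + 2))) :=
    fun v => (Prog.exec_move_aux₂_aux₁ (blank_notMem x) v r _ c).runs.seq fun v =>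
      (runs_restore x v r _ c).seq fun v => runs_restore y v _ b c
  have h' := fun v =>
    Prog.exec_move_aux₁_aux₂ (blank_notMem_reverse x) v (enc y ++ r) b (.blank :: c)
  simp only [List.reverse_reverse, List.length_reverse] at h'
  refine ((runs_save x v (enc y ++ r) b c).seq fun v => (Prog.Exec.push _ _ _).seq_runs <|
    (h' v).runs.seq fun v => (runs_save y v r b _).seq fun v =>
    (Prog.Exec.push _ _ _).seq_runs (h v)).mono ?_
  rw [size_mk, ← size]
  nlinarith

theorem snd : PolyTime fun x : α × β => x.2 := by
  -- The loop body has no net effect and keeps the symbol read, so the saved word is simply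
  -- discarded.
  refine of_linear (.seq (save α) (Prog.untilBlank .aux₁
    (.seq (.push .aux₂ fun v => v.getD .blank) (.pop .aux₂)))) (factor α + 4) 3 fun x v r b c => ?_
  obtain ⟨x, y⟩ := x
  simp only [enc_mk, List.append_assoc]
  refine ((runs_save x v (enc y ++ r) b c).seq fun v =>
    (Prog.exec_untilBlank (k := 2) (fun v _ w => ⟨v, enc y ++ r, w, c⟩) (fun _ _ _ => rfl)
      (fun _ _ _ => rfl) (fun _ _ _ => (Prog.Exec.push _ _ _).seq (Prog.Exec.pop _ _))
      (blank_notMem_reverse x) v [] b).runs).mono ?_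
  rw [List.length_reverse, ← size, size_mk]
  nlinarith

theorem fst : PolyTime fun x : α × β => x.1 := snd.comp swap

theorem pair {f : α → β} {g : α → γ} (hf : PolyTime f) (hg : PolyTime g) :
    PolyTime fun x => (f x, g x) :=
  (hg.map_snd (α := β)).comp ((hf.map_fst (γ := α)).comp dup)

theorem cons' : PolyTime fun x : α × List α => x.1 :: x.2 := by
  refine of_linear (.push .main fun _ => .bra) 0 1 fun x v r b c => ?_
  have := Prog.Exec.push .main (fun _ => .bra) ⟨v, enc x ++ r, b, c⟩
  exact this.runs.mono (by simp)

theorem cons {f : α → β} {g : α → List β} (hf : PolyTime f) (hg : PolyTime g) :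
    PolyTime fun x => f x :: g x :=
  cons'.comp (hf.pair hg)

theorem cond' {f g : α → β} (hf : PolyTime f) (hg : PolyTime g) :
    PolyTime fun x : Bool × α => cond x.1 (f x.2) (g x.2) := by
  obtain ⟨p, P, hp⟩ := hf
  obtain ⟨q, Q, hq⟩ := hg
  refine ⟨.seq (.pop .main) (.ite (fun v => decide (v = some (.bit true))) p q),
    P + Q + 2, fun x v r b c => ?_⟩
  obtain ⟨d, x⟩ := x
  have hP := P.eval_mono_nat (m := size x) (n := size (d, x)) (by simp)
  have hQ := Q.eval_mono_nat (m := size x) (n := size (d, x)) (by simp)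
  have h := Prog.Exec.pop .main ⟨v, enc (d, x) ++ r, b, c⟩
  simp only [Polynomial.eval_add, Polynomial.eval_ofNat]
  cases d with
  | true =>
    obtain ⟨v', t, h', ht⟩ := hp x (some (.bit true)) r b c
    exact ⟨v', _, h.seq (.ite_true rfl h'), by omega⟩
  | false =>
    obtain ⟨v', t, h', ht⟩ := hq x (some (.bit false)) r b c
    exact ⟨v', _, h.seq (.ite_false rfl h'), by omega⟩

theorem cond {d : α → Bool} {f g : α → β} (hd : PolyTime d) (hf : PolyTime f) (hg : PolyTime g) :
    PolyTime fun x => cond (d x) (f x) (g x) :=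
  (cond' hf hg).comp (hd.pair PolyTime.id)

/-- Once the leading `.bra` is popped, the word of `y :: ys` is already that of the pair `(y, ys)`.
-/
theorem list_casesOn' {f : γ → β} {g : γ × α × List α → β} (hf : PolyTime f) (hg : PolyTime g) :
    PolyTime fun x : List α × γ =>
      (match x.1 with | [] => f x.2 | y :: ys => g (x.2, y, ys) : β) := by
  have hg' : PolyTime fun x : (α × List α) × γ => g (x.2, x.1) := hg.comp swap
  obtain ⟨p, P, hp⟩ := hf
  obtain ⟨q, Q, hq⟩ := hg'
  refine ⟨.seq (.pop .main) (.ite (fun v => decide (v = some .ket)) p q),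
    P + Q + 2, fun x v r b c => ?_⟩
  obtain ⟨l, x⟩ := x
  have h := Prog.Exec.pop .main ⟨v, enc (l, x) ++ r, b, c⟩
  simp only [Polynomial.eval_add, Polynomial.eval_ofNat]
  cases l with
  | nil =>
    have hP := P.eval_mono_nat (m := size x) (n := size (([] : List α), x)) (by simp)
    obtain ⟨v', t, h', ht⟩ := hp x (some .ket) r b c
    exact ⟨v', _, h.seq (.ite_true rfl h'), by omega⟩
  | cons y ys =>
    have hQ := Q.eval_mono_nat (m := size ((y, ys), x)) (n := size (y :: ys, x)) (by simp)
    obtain ⟨v', t, h', ht⟩ := hq ((y, ys), x) (some .bra) r b c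
    exact ⟨v', _, h.seq (.ite_false rfl h'), by omega⟩

theorem list_casesOn {l : γ → List α} {f : γ → β} {g : γ → α → List α → β} (hl : PolyTime l)
    (hf : PolyTime f) (hg : PolyTime fun x : γ × α × List α => g x.1 x.2.1 x.2.2) :
    PolyTime fun x => (match l x with | [] => f x | y :: ys => g x y ys : β) :=
  (list_casesOn' hf hg).comp (hl.pair PolyTime.id)

/-- Iterating a polynomial-time step may blow up the accumulator, so a polynomial bound `B` on all
results of the fold is assumed. Applied to prefixes of the list, it bounds every intermediate
accumulator. -/
theorem foldl' {f : β → α → β} (hf : PolyTime fun x : β × α => f x.1 x.2) (B : Polynomial ℕ)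
    (hB : ∀ l s, size (List.foldl f s l) ≤ B.eval (size l + size s)) :
    PolyTime fun x : List α × β => x.1.foldl f x.2 := by
  have hg : PolyTime fun x : α × List α × β => (x.2.1, f x.2.2 x.1) :=
    (fst.comp snd).pair (hf.comp ((snd.comp snd).pair fst))
  obtain ⟨p, P, hp⟩ := hg
  let b₀ : Option Γ' → Bool := fun v => decide (v = some .bra)
  have key : ∀ (A N : ℕ) (r b c) (l : List α) (s : β), size l ≤ A →
      (∀ l', l' <+: l → size (l'.foldl f s) ≤ N) → ∃ v' t,
      Prog.Exec (.loop b₀ (.seq p (.pop .main)))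
        ⟨(enc l).head?, (enc l).tail ++ (enc s ++ r), b, c⟩
        ⟨v', enc (l.foldl f s) ++ r, b, c⟩ t ∧ t ≤ (P.eval (A + N) + 2) * size l := by
    intro A N r b c l
    induction l with
    | nil =>
      intro s _ _
      refine ⟨_, _, Prog.Exec.loop_false rfl, ?_⟩
      simp
    | cons x l ih =>
      intro s hA hN
      obtain ⟨v₁, t₁, h₁, ht₁⟩ := hp (x, l, s) (some .bra) r b c
      obtain ⟨v₂, t₂, h₂, ht₂⟩ := ih (f s x) (by simp at hA; omega) fun l' hl' =>
        hN (x :: l') (by simpa using hl')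
      have hs := hN [] (List.nil_prefix)
      have hP := P.eval_mono_nat (m := size (x, l, s)) (n := A + N) (by
        simp at hA hs ⊢; omega)
      obtain ⟨g, w, hgw⟩ : ∃ g w, enc l = g :: w := by
        cases l <;> exact ⟨_, _, rfl⟩
      have h₃ := h₁.seq (Prog.Exec.pop .main _)
      rw [hgw] at h₂
      have h₄ : Prog.Exec (.seq p (.pop .main)) ⟨some .bra, enc (x, l, s) ++ r, b, c⟩
          ⟨some g, w ++ (enc (f s x) ++ r), b, c⟩ (t₁ + 1) := by
        simpa [enc_mk, hgw, Stk.Mem.pop] using h₃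
      refine ⟨v₂, t₂ + (t₁ + 1 + 1), ?_, ?_⟩
      · have := Prog.Exec.loop_true (b := b₀) rfl h₄ h₂
        simpa [enc_mk, enc_cons] using this
      · simp only [size_cons]
        nlinarith
  refine ⟨.seq (.pop .main) (.loop b₀ (.seq p (.pop .main))),
    1 + (P.comp (.X + B) + 2) * .X, fun x v r b c => ?_⟩
  obtain ⟨l, s⟩ := x
  obtain ⟨v', t, h, ht⟩ := key (size (l, s)) (B.eval (size (l, s))) r b c l s (by simp)
    fun l' hl' => (hB l' s).trans (B.eval_mono_nat (by
      obtain ⟨l'', rfl⟩ := hl'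
      have := size_append l' l''
      have := one_le_size_list l''
      simp only [size_mk]; omega))
  obtain ⟨g, w, hgw⟩ : ∃ g w, enc l = g :: w := by
    cases l <;> exact ⟨_, _, rfl⟩
  have h₀ := Prog.Exec.pop .main ⟨v, enc (l, s) ++ r, b, c⟩
  rw [hgw] at h
  have h₁ : Prog.Exec (.pop .main) ⟨v, enc (l, s) ++ r, b, c⟩
    ⟨some g, w ++ (enc s ++ r), b, c⟩ 1 := by simpa [enc_mk, hgw, Stk.Mem.pop] using h₀
  refine ⟨v', 1 + t, h₁.seq h, ?_⟩
  simp only [Polynomial.eval_add, Polynomial.eval_mul, Polynomial.eval_X, Polynomial.eval_comp,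
    Polynomial.eval_one, Polynomial.eval_ofNat]
  have : size l ≤ size (l, s) := by simp
  have := Nat.mul_le_mul_left (P.eval (size (l, s) + B.eval (size (l, s))) + 2) this
  omega

/-- A function that is iterated along a list preserves polynomial time if each step adds to the
size of the accumulator an amount that does not depend on the accumulator. -/
theorem foldl {l : γ → List α} {s : γ → β} {f : γ → β → α → β} (hl : PolyTime l) (hs : PolyTime s)
    (hf : PolyTime fun x : γ × β × α => f x.1 x.2.1 x.2.2)
    (hG : ∃ G : Polynomial ℕ, ∀ c b x, size (f c b x) ≤ size b + G.eval (size c + size x)) :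
    PolyTime fun c => (l c).foldl (f c) (s c) := by
  obtain ⟨G, hG⟩ := hG
  -- The parameter travels along in the accumulator, because the step of `foldl'` has no access to
  -- it.
  let F : γ × β → α → γ × β := fun y x => (y.1, f y.1 y.2 x)
  have hF : PolyTime fun x : (γ × β) × α => F x.1 x.2 :=
    (fst.comp fst).pair (hf.comp ((fst.comp fst).pair ((snd.comp fst).pair snd)))
  have hfold : ∀ (l : List α) c b, l.foldl F (c, b) = (c, l.foldl (f c) b) := by
    intro l
    induction l with
    | nil => intros; rfl
    | cons x l ih => intro c b; exact ih c _
  have hsize : ∀ (l : List α) c b (N : ℕ), size c + size l ≤ N →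
      size (l.foldl (f c) b) ≤ size b + l.length * G.eval N := by
    intro l
    induction l with
    | nil => intros; simp
    | cons x l ih =>
      intro c b N hN
      simp only [size_cons] at hN
      have h₁ := ih c (f c b x) N (by omega)
      have h₂ := hG c b x
      have h₃ := G.eval_mono_nat (m := size c + size x) (n := N) (by omega)
      simp only [List.foldl_cons, List.length_cons, add_mul, one_mul]
      omega
  have key : PolyTime fun x : List α × γ × β => x.1.foldl F x.2 := by
    refine foldl' hF (.X + .X * G) fun l y => ?_
    obtain ⟨c, b⟩ := y
    rw [hfold]
    have h₁ := hsize l c b (size l + size (c, b)) (by simp; omega)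
    have h₂ := length_lt_size l
    simp only [Polynomial.eval_add, Polynomial.eval_mul, Polynomial.eval_X]
    have h₃ := Nat.mul_le_mul_right (G.eval (size l + size (c, b)))
      (h₂.le.trans (Nat.le_add_right _ (size (c, b))))
    rw [size_mk]
    rw [size_mk] at h₁ h₃ ⊢
    omega
  have := snd.comp (key.comp (hl.pair (PolyTime.id.pair hs)))
  simpa only [hfold] using this

end PolyTime

namespace PolyTime

variable {α β γ δ : Type} [Enc α] [Enc β] [Enc γ] [Enc δ]

theorem const (y : β) : PolyTime fun _ : α => y := by
  -- Pushing the fixed word of `y` above the argument yields a pair, whose second component is then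
  -- dropped.
  refine fst.comp (f := fun x : α => (y, x)) ?_
  have key : ∀ w : List Γ', ∃ p : Prog, ∀ v r b c,
      p.Runs ⟨v, r, b, c⟩ (w ++ r) b c (w.length + 2) := by
    intro w
    induction w with
    | nil =>
      exact ⟨.seq (.push .aux₁ fun _ => .blank) (.pop .aux₁), fun v r b c =>
        ((Prog.Exec.push _ _ _).seq (Prog.Exec.pop _ _)).runs⟩
    | cons g w ih =>
      obtain ⟨p, hp⟩ := ih
      exact ⟨.seq p (.push .main fun _ => g), fun v r b c =>
        ((hp v r b c).seq fun v => (Prog.Exec.push _ _ _).runs).mono (by simp)⟩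
  obtain ⟨p, hp⟩ := key (enc y)
  refine of_linear p 0 ((enc y).length + 2) fun x v r b c => ?_
  rw [enc_mk, List.append_assoc]
  exact (hp v _ b c).mono (by simp)

theorem fst_comp {f : α → β × γ} (hf : PolyTime f) : PolyTime fun x => (f x).1 := fst.comp hf

theorem snd_comp {f : α → β × γ} (hf : PolyTime f) : PolyTime fun x => (f x).2 := snd.comp hf

theorem and {f g : α → Bool} (hf : PolyTime f) (hg : PolyTime g) :
    PolyTime fun x => f x && g x := by
  have := cond hf hg (const false)
  refine (congrArg PolyTime (funext fun x => ?_)).mp this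
  cases f x <;> rfl

theorem or {f g : α → Bool} (hf : PolyTime f) (hg : PolyTime g) :
    PolyTime fun x => f x || g x := by
  have := cond hf (const true) hg
  refine (congrArg PolyTime (funext fun x => ?_)).mp this
  cases f x <;> rfl

theorem not {f : α → Bool} (hf : PolyTime f) : PolyTime fun x => !f x := by
  have := cond hf (const false) (const true)
  refine (congrArg PolyTime (funext fun x => ?_)).mp this
  cases f x <;> rfl

attribute [fun_prop] PolyTime.id const comp fst_comp snd_comp pair cons cond and or not

theorem any {l : γ → List α} {q : γ → α → Bool} (hl : PolyTime l)
    (hq : PolyTime fun x : γ × α => q x.1 x.2) : PolyTime fun c => (l c).any (q c) := by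
  have hq' : PolyTime fun x : γ × Bool × α => q x.1 x.2.2 :=
    hq.comp (f := fun x : γ × Bool × α => (x.1, x.2.2)) (by fun_prop)
  have := foldl (s := fun _ => false) (f := fun c b x => b || q c x) hl (const _) (by fun_prop)
    ⟨0, by simp⟩
  refine (congrArg PolyTime (funext fun c => ?_)).mp this
  suffices ∀ (l : List α) b, l.foldl (fun b x => b || q c x) b = (b || l.any (q c)) by
    simp [this]
  intro l
  induction l with
  | nil => simp
  | cons x l ih => simp [ih, Bool.or_assoc]

theorem reverse {l : γ → List α} (hl : PolyTime l) : PolyTime fun c => (l c).reverse := by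
  have := foldl (s := fun _ => []) (f := fun _ acc x => x :: acc) hl (const _) (by fun_prop)
    ⟨.X + 1, fun _ _ _ => by simp; omega⟩
  refine (congrArg PolyTime (funext fun c => ?_)).mp this
  simp

attribute [fun_prop] reverse any

end PolyTime

/-! ### The decision procedure on lists of binary numbers -/

/-- Elimination of lists, without recursion. -/
def listElim {α β : Type} (l : List α) (b : β) (g : α → List α → β) : β :=
  match l with
  | [] => b
  | x :: xs => g x xs

@[simp] theorem listElim_nil {α β : Type} (b : β) (g : α → List α → β) :
    listElim [] b g = b := rfl

@[simp] theorem listElim_cons {α β : Type} (x : α) (l : List α) (b : β) (g : α → List α → β) :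
    listElim (x :: l) b g = g x l := rfl

@[fun_prop]
theorem PolyTime.listElim {α β γ : Type} [Enc α] [Enc β] [Enc γ] {l : γ → List α} {f : γ → β}
    {g : γ → α → List α → β} (hl : PolyTime l) (hf : PolyTime f)
    (hg : PolyTime fun x : γ × α × List α => g x.1 x.2.1 x.2.2) :
    PolyTime fun c => listElim (l c) (f c) (g c) :=
  list_casesOn hl hf hg

/-- The test `a ≤ b` for binary numbers with the least significant bit first. -/
def binLE (a b : List Bool) : Bool :=
  let s := a.foldl (fun (s : List Bool × Bool) x =>
    listElim s.1 ([], s.2 && !x) fun y ys => (ys, bif x then y && s.2 else y || s.2)) (b, true)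
  s.2 || s.1.any fun y => y

@[fun_prop]
theorem PolyTime.binLE {γ : Type} [Enc γ] {f g : γ → List Bool} (hf : PolyTime f)
    (hg : PolyTime g) : PolyTime fun c => binLE (f c) (g c) := by
  unfold _root_.binLE
  have := foldl (s := fun c => (g c, true)) (f := fun _ (s : List Bool × Bool) x =>
    _root_.listElim s.1 ([], s.2 && !x) fun y ys => (ys, bif x then y && s.2 else y || s.2)) hf
    (by fun_prop) (by fun_prop) ⟨0, by
      rintro c ⟨_ | ⟨y, l⟩, b⟩ x
      · simp
      · simp; omega⟩
  fun_prop

/-- Equality of binary numbers. -/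
def binEq (a b : List Bool) : Bool := binLE a b && binLE b a

@[fun_prop]
theorem PolyTime.binEq {γ : Type} [Enc γ] {f g : γ → List Bool} (hf : PolyTime f)
    (hg : PolyTime g) : PolyTime fun c => binEq (f c) (g c) := by
  unfold _root_.binEq
  fun_prop

/-- Evenness of binary numbers. -/
def binEven (a : List Bool) : Bool := listElim a true fun b _ => !b

@[fun_prop]
theorem PolyTime.binEven {γ : Type} [Enc γ] {f : γ → List Bool} (hf : PolyTime f) :
    PolyTime fun c => binEven (f c) := by
  unfold _root_.binEven
  fun_prop

/-- Split a word, given as a list of bits and of empty lists that stand for commas, into the binary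
numbers that are terminated by the commas. -/
def parseNumbers (w : List (List Bool)) : List (List Bool) :=
  w.reverse.foldl (fun out t =>
    listElim t ([] :: out) fun b _ => listElim out [] fun q qs => (b :: q) :: qs) []

@[fun_prop]
theorem PolyTime.parseNumbers {γ : Type} [Enc γ] {f : γ → List (List Bool)} (hf : PolyTime f) :
    PolyTime fun c => parseNumbers (f c) := by
  refine foldl (f := fun _ (out : List (List Bool)) t =>
    _root_.listElim t ([] :: out) fun b _ => _root_.listElim out [] fun q qs => (b :: q) :: qs)
    (by fun_prop) (by fun_prop) (by fun_prop) ⟨2, ?_⟩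
  rintro c (_ | ⟨q, qs⟩) (_ | ⟨b, l⟩) <;> simp <;> omega

/-- A transition: its source, letter, target and priority. -/
abbrev BinTrans : Type := List Bool × List Bool × List Bool × List Bool

/-- Group a list of numbers into quadruples. -/
def parseTrans (l : List (List Bool)) : List BinTrans :=
  (l.foldl (fun (s : List (List Bool) × List BinTrans) d =>
    listElim s.1 ([d], s.2) fun c s₁ => listElim s₁ ([d, c], s.2) fun b s₂ =>
    listElim s₂ ([d, c, b], s.2) fun a _ => ([], (a, b, c, d) :: s.2)) ([], [])).2

@[fun_prop]
theorem PolyTime.parseTrans {γ : Type} [Enc γ] {f : γ → List (List Bool)} (hf : PolyTime f) :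
    PolyTime fun c => parseTrans (f c) := by
  unfold _root_.parseTrans
  have := foldl (f := fun _ (s : List (List Bool) × List BinTrans) d =>
    _root_.listElim s.1 ([d], s.2) fun c s₁ => _root_.listElim s₁ ([d, c], s.2) fun b s₂ =>
    _root_.listElim s₂ ([d, c, b], s.2) fun a _ => ([], (a, b, c, d) :: s.2))
    (s := fun _ => ([], [])) hf (by fun_prop) (by fun_prop) ⟨.X + 4, by
      rintro c ⟨_ | ⟨a, _ | ⟨b, _ | ⟨c, s⟩⟩⟩, out⟩ d <;> simp <;> omega⟩
  fun_prop

/-- The transitions of priority at most `l`. -/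
def transLE (T : List BinTrans) (l : List Bool) : List BinTrans :=
  T.foldl (fun acc t => bif binLE t.2.2.2 l then t :: acc else acc) []

@[fun_prop]
theorem PolyTime.transLE {γ : Type} [Enc γ] {f : γ → List BinTrans} {g : γ → List Bool}
    (hf : PolyTime f) (hg : PolyTime g) : PolyTime fun c => transLE (f c) (g c) := by
  have := foldl (l := fun c : List BinTrans × List Bool => c.1) (s := fun _ => [])
    (f := fun c (acc : List BinTrans) t =>
      bif _root_.binLE t.2.2.2 c.2 then t :: acc else acc) (by fun_prop) (by fun_prop)
    (by fun_prop) ⟨.X + 1, by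
      intro c acc t
      cases _root_.binLE t.2.2.2 c.2
      · simp
      · simp; omega⟩
  exact this.comp (hf.pair hg)

/-- The list `R₀` extended by the targets of the transitions in `E` with sources in `R`. -/
def reachStep (E : List BinTrans) (R₀ R : List (List Bool)) : List (List Bool) :=
  E.foldl (fun acc t => bif R.any (fun q => binEq q t.1) then t.2.2.1 :: acc else acc) R₀

/-- The bound does not involve `R`, because a step restarts from `R₀` instead of extending `R`. This
keeps the lists small when the step is iterated. -/
theorem size_reachStep_le (E : List BinTrans) (R₀ R : List (List Bool)) :
    size (reachStep E R₀ R) ≤ size R₀ + size E := by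
  unfold reachStep
  induction E generalizing R₀ with
  | nil => simp
  | cons t E ih =>
    refine (ih _).trans ?_
    obtain ⟨a, b, c, d⟩ := t
    by_cases h : (R.any fun q => binEq q a) = true <;> simp [h] <;> omega

@[fun_prop]
theorem PolyTime.reachStep {γ : Type} [Enc γ] {f : γ → List BinTrans} {g h : γ → List (List Bool)}
    (hf : PolyTime f) (hg : PolyTime g) (hh : PolyTime h) :
    PolyTime fun c => reachStep (f c) (g c) (h c) := by
  have := foldl (l := fun c : List BinTrans × List (List Bool) × List (List Bool) => c.1)
    (s := fun c => c.2.1) (f := fun c acc t =>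
      bif c.2.2.any (fun q => _root_.binEq q t.1) then t.2.2.1 :: acc else acc) (by fun_prop)
    (by fun_prop) (by fun_prop) ⟨.X + 1, by
      rintro c acc ⟨a, b, t, d⟩
      cases c.2.2.any (fun q => _root_.binEq q a)
      · simp
      · simp; omega⟩
  exact this.comp (hf.pair (hg.pair hh))

/-- The states that can be reached from `u` by transitions in `E`. -/
def reach (E : List BinTrans) (u : List Bool) : List (List Bool) :=
  E.foldl (fun R _ => reachStep E [u] R) [u]

@[fun_prop]
theorem PolyTime.reach {γ : Type} [Enc γ] {f : γ → List BinTrans} {g : γ → List Bool}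
    (hf : PolyTime f) (hg : PolyTime g) : PolyTime fun c => reach (f c) (g c) := by
  have := foldl (l := fun c : List BinTrans × List Bool => c.1)
    (s := fun c => [c.2]) (f := fun c R _ => _root_.reachStep c.1 [c.2] R) (by fun_prop)
    (by fun_prop) (by fun_prop) ⟨.X + 2, by
      rintro ⟨E, u⟩ R t
      have := size_reachStep_le E [u] R
      simp at this ⊢
      omega⟩
  exact this.comp (hf.pair hg)

/-- Some state in `R` equals `v`. -/
def binMem (v : List Bool) (R : List (List Bool)) : Bool := R.any fun q => binEq q v

@[fun_prop]
theorem PolyTime.binMem {γ : Type} [Enc γ] {f : γ → List Bool} {g : γ → List (List Bool)}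
    (hf : PolyTime f) (hg : PolyTime g) : PolyTime fun c => binMem (f c) (g c) := by
  unfold _root_.binMem
  fun_prop

/-- The test whether the transitions `t₁` and `t₂` violate limit-determinism on a cycle through `t₁`
and `t₃` whose highest priority is that of `t₃`. -/
def isViolation (T : List BinTrans) (u₀ : List Bool) (t₁ t₂ t₃ : BinTrans) : Bool :=
  binEven t₃.2.2.2 && binLE t₁.2.2.2 t₃.2.2.2 && binLE t₂.2.2.2 t₃.2.2.2 &&
  binEq t₁.1 t₂.1 && binEq t₁.2.1 t₂.2.1 && !binEq t₁.2.2.1 t₂.2.2.1 &&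
  binMem t₁.1 (reach T u₀) &&
  binMem t₃.1 (reach (transLE T t₃.2.2.2) t₁.2.2.1) &&
  binMem t₁.1 (reach (transLE T t₃.2.2.2) t₃.2.2.1)

@[fun_prop]
theorem PolyTime.isViolation {γ : Type} [Enc γ] {f : γ → List BinTrans} {g : γ → List Bool}
    {t₁ t₂ t₃ : γ → BinTrans} (hf : PolyTime f) (hg : PolyTime g) (h₁ : PolyTime t₁)
    (h₂ : PolyTime t₂) (h₃ : PolyTime t₃) :
    PolyTime fun c => isViolation (f c) (g c) (t₁ c) (t₂ c) (t₃ c) := by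
  unfold _root_.isViolation
  fun_prop

/-- The test whether no triple of transitions violates limit-determinism. -/
def noViolation (T : List BinTrans) (u₀ : List Bool) : Bool :=
  !T.any fun t₁ => T.any fun t₂ => T.any fun t₃ => isViolation T u₀ t₁ t₂ t₃

@[fun_prop]
theorem PolyTime.noViolation {γ : Type} [Enc γ] {f : γ → List BinTrans} {g : γ → List Bool}
    (hf : PolyTime f) (hg : PolyTime g) : PolyTime fun c => noViolation (f c) (g c) := by
  unfold _root_.noViolation
  fun_prop

/-- The test for limit-determinism, applied to the word that represents a parity automaton. -/
def checkLimitDeterministic (w : List (List Bool)) : Bool :=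
  -- The default values are irrelevant: the word of an automaton always starts with three numbers.
  listElim (parseNumbers w) true fun _ l₁ => listElim l₁ true fun _ l₂ =>
    listElim l₂ true fun u₀ l => noViolation (parseTrans l) u₀

theorem PolyTime.checkLimitDeterministic : PolyTime checkLimitDeterministic := by
  unfold _root_.checkLimitDeterministic
  fun_prop

/-! ### From the input word to a machine for the decision problem -/

namespace Prog

/-- Pop all symbols from the stack `i` and run `p` after each of them. -/
def untilEmpty (i : Stk) (p : Prog) : Prog :=
  .seq (.pop i) (.loop Option.isSome (.seq p (.pop i)))

theorem exec_untilEmpty {X : Type} {i : Stk} {p : Prog} {k : ℕ}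
    (m : Option Γ' → X → List Γ' → Mem) (step : X → Γ' → X)
    (hvar : ∀ v x w, (m v x w).var = v) (hpop : ∀ v x w, (m v x w).pop i = m w.head? x w.tail)
    (hp : ∀ g x w, ∃ v t, Exec p (m (some g) x w) (m v (step x g) w) t ∧ t ≤ k) (w v x) :
    ∃ t, Exec (untilEmpty i p) (m v x w) (m none (w.foldl step x) []) t ∧
      t ≤ (k + 2) * w.length + 2 := by
  have key : ∀ (w : List Γ') x, ∃ t, Exec (.loop Option.isSome (.seq p (.pop i)))
      (m w.head? x w.tail) (m none (w.foldl step x) []) t ∧ t ≤ (k + 2) * w.length + 1 := by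
    intro w
    induction w with
    | nil => exact fun x => ⟨1, Exec.loop_false (by rw [hvar]; rfl), by simp⟩
    | cons g w ih =>
      intro x
      obtain ⟨v₁, t₁, h₁, ht₁⟩ := hp g x w
      obtain ⟨t₂, h₂, ht₂⟩ := ih (step x g)
      have h₃ := h₁.seq (Exec.pop i _)
      rw [hpop] at h₃
      refine ⟨_, Exec.loop_true (by rw [hvar]; rfl) h₃ h₂, ?_⟩
      simp only [List.length_cons]
      nlinarith
  obtain ⟨t, h, ht⟩ := key w x
  have h₀ := Exec.pop i (m v x w)
  rw [hpop] at h₀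
  exact ⟨_, h₀.seq h, by omega⟩

/-- The list of bits that represents a symbol of the input: commas become empty lists. -/
def token : Γ' → List Bool
  | .bit b => [b]
  | _ => []

/-- Replace the input by the word that represents the list of its symbols. -/
def tokenize : Prog :=
  let isBit : Option Γ' → Bool := fun v => decide (v = some (.bit true) ∨ v = some (.bit false))
  .seq (untilEmpty .main (.push .aux₁ fun v => v.getD .blank)) <| .seq (.push .main fun _ => .ket) <|
    untilEmpty .aux₁ <| .seq (.push .main fun _ => .ket) <|
      .ite isBit (.seq (.push .main fun v => v.getD .blank) <|
        .seq (.push .main fun _ => .bra) (.push .main fun _ => .bra)) (.push .main fun _ => .bra)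

/-- Words on a stack are built from their ends, so the input is first reversed onto `aux₁`. A bit
then costs at most 5 steps: one branch and four pushes, for the one-element list and the `.bra` that
conses it. -/
theorem exec_tokenize (w : List Γ') :
    ∃ v t, Exec tokenize ⟨none, w, [], []⟩ ⟨v, enc (w.map token), [], []⟩ t ∧
      t ≤ 10 * w.length + 5 := by
  obtain ⟨t₁, h₁, ht₁⟩ := exec_untilEmpty (i := .main) (p := .push .aux₁ fun v => v.getD .blank)
    (k := 1) (fun v x w => ⟨v, w, x, []⟩) (fun x g => g :: x) (fun _ _ _ => rfl)
    (fun _ _ _ => rfl) (fun g x w => ⟨_, _, Exec.push _ _ _, le_rfl⟩) w none []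
  let isBit : Option Γ' → Bool := fun v => decide (v = some (.bit true) ∨ v = some (.bit false))
  have hbody : ∀ g (x : List (List Bool)) w, ∃ v t,
      Exec (.seq (.push .main fun _ => .ket) <|
        .ite isBit (.seq (.push .main fun v => v.getD .blank) <|
          .seq (.push .main fun _ => .bra) (.push .main fun _ => .bra)) (.push .main fun _ => .bra))
        ⟨some g, enc x, w, []⟩ ⟨v, enc (token g :: x), w, []⟩ t ∧ t ≤ 5 := by
    intro g x w
    have h₀ := Exec.push .main (fun _ => .ket) ⟨some g, enc x, w, []⟩
    rcases g with _ | b | _ | _ | _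
    on_goal 2 =>
      exact ⟨_, _, h₀.seq (.ite_true (by cases b <;> rfl)
        ((Exec.push _ _ _).seq ((Exec.push _ _ _).seq (Exec.push _ _ _)))), le_rfl⟩
    all_goals exact ⟨_, _, h₀.seq (.ite_false rfl (Exec.push _ _ _)), by omega⟩
  obtain ⟨t₂, h₂, ht₂⟩ := exec_untilEmpty (i := .aux₁) (k := 5)
    (fun v (x : List (List Bool)) w => ⟨v, enc x, w, []⟩) (fun x g => token g :: x)
    (fun _ _ _ => rfl) (fun _ _ _ => rfl) hbody w.reverse none []
  have hr : w.foldl (fun x g => g :: x) [] = w.reverse := by simp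
  have hm : w.reverse.foldl (fun x g => token g :: x) [] = w.map token := by
    rw [List.foldl_reverse]
    induction w <;> simp_all
  rw [hr] at h₁
  rw [hm] at h₂
  refine ⟨none, t₁ + (1 + t₂), h₁.seq ((Exec.push _ _ _).seq h₂), ?_⟩
  rw [List.length_reverse] at ht₂
  omega

end Prog

open Turing in
theorem PolyTime.decidableInPolyTime {X : Type} {e : X → List Γ'} {p : X → Prop}
    {g : List (List Bool) → Bool} (hg : PolyTime g)
    (h : ∀ x, g ((e x).map Prog.token) = true ↔ p x) : DecidableInPolyTime e p := by
  refine ⟨fun x => g ((e x).map Prog.token), h, ?_⟩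
  obtain ⟨q, Q, hq⟩ := hg
  -- A token has size at most 3, and one more symbol conses it to the list.
  have hsize : ∀ w : List Γ', size (w.map Prog.token) ≤ 4 * w.length + 1 := by
    intro w
    induction w with
    | nil => simp
    | cons g w ih =>
      have : size (Prog.token g) ≤ 3 := by cases g <;> simp [Prog.token]
      simp only [List.map_cons, size_cons, List.length_cons]
      omega
  have key : ∀ x, Nonempty (TM2OutputsInTime
      (Prog.machine (.seq .tokenize (.seq q (.pop .main)))) (e x)
      (some [g ((e x).map Prog.token)])
      ((10 * .X + 7 + Q.comp (4 * .X + 1) : Polynomial ℕ).eval (e x).length)) := by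
    intro x
    obtain ⟨v₁, t₁, h₁, ht₁⟩ := Prog.exec_tokenize (e x)
    obtain ⟨v₂, t₂, h₂, ht₂⟩ := hq ((e x).map Prog.token) v₁ [] [] []
    rw [List.append_nil] at h₂
    have h₃ := h₁.seq (h₂.seq (Prog.Exec.pop .main _))
    refine Prog.exists_outputsInTime h₃ ?_
    have := Q.eval_mono_nat (hsize (e x))
    simp only [Polynomial.eval_add, Polynomial.eval_mul, Polynomial.eval_X, Polynomial.eval_comp,
      Polynomial.eval_one, Polynomial.eval_ofNat]
    omega
  exact ⟨{
    tm := Prog.machine (.seq .tokenize (.seq q (.pop .main)))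
    inputAlphabet := Equiv.refl _
    outputAlphabet := Equiv.refl _
    time := 10 * .X + 7 + Q.comp (4 * .X + 1)
    outputsFun := fun x => by
      have h₁ : (e x).map (Equiv.refl (Prog.Alphabet (some .main))).invFun = e x :=
        List.map_id _
      exact Eq.mpr (congrArg (fun w => TM2OutputsInTime _ w _ _) h₁) (key x).some }⟩

/-! ### Limit-determinism in terms of closed walks -/

namespace ParityAutomaton

open Filter Relation

variable {V S : Type*} (A : ParityAutomaton V S)

/-- There is a transition with the property `p` from `v` to `u`. -/
def Edge (p : A.δ → Prop) (v u : V) : Prop := ∃ t : A.δ, p t ∧ t.1.1 = v ∧ t.1.2.2 = u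

/-- Two transitions from the same state under the same letter, the first of them on a cycle that
is reachable from the initial state and whose highest priority is even and at least the priorities
of both transitions. -/
def HasViolation : Prop :=
  ∃ t₁ t₂ t₃ : A.δ, Even (A.α t₃) ∧ A.α t₁ ≤ A.α t₃ ∧ A.α t₂ ≤ A.α t₃ ∧
    t₁.1.1 = t₂.1.1 ∧ t₁.1.2.1 = t₂.1.2.1 ∧ t₁.1.2.2 ≠ t₂.1.2.2 ∧
    ReflTransGen (A.Edge fun _ => True) A.u₀ t₁.1.1 ∧
    ReflTransGen (A.Edge fun t => A.α t ≤ A.α t₃) t₁.1.2.2 t₃.1.1 ∧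
    ReflTransGen (A.Edge fun t => A.α t ≤ A.α t₃) t₃.1.2.2 t₁.1.1

variable {A}

theorem Run.reflTransGen {v : V} {w : ℕ → S} (ρ : A.Run v w) (p : A.δ → Prop) {i j : ℕ}
    (hij : i ≤ j) (hp : ∀ k, i ≤ k → p (ρ.trans k)) :
    ReflTransGen (A.Edge p) (ρ.state i) (ρ.state j) := by
  induction j, hij using Nat.le_induction with
  | base => exact .refl
  | succ k hk ih => exact ih.tail ⟨ρ.trans k, hp k hk, rfl, rfl⟩

theorem hasViolation_of_not_limitDeterministic [Finite A.δ] (h : ¬ A.LimitDeterministic) :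
    A.HasViolation := by
  unfold LimitDeterministic at h
  push Not at h
  obtain ⟨w, ρ, ⟨l', hl', heven⟩, l, hl, hρ⟩ := h
  obtain rfl := hl'.unique hl
  -- Each transition of priority above `l'` is taken only finitely often, and there are finitely
  -- many transitions.
  have hle : ∀ᶠ i in atTop, A.α (ρ.trans i) ≤ l' := by
    have h : ∀ᶠ i in atTop, ∀ t : A.δ, l' < A.α t → ρ.trans i ≠ t := by
      refine eventually_all.2 fun t => ?_
      by_cases ht : l' < A.α t
      · have h : ¬ ∃ᶠ i in atTop, ρ.trans i = t := fun h =>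
          absurd (hl.2 (h.mono fun i hi => by simp [hi] : A.α t ∈ infOften (A.α ∘ ρ.trans)))
            ht.not_ge
        filter_upwards [not_frequently.1 h] with i hi _ using hi
      · exact .of_forall fun i h => absurd h ht
    filter_upwards [h] with i hi
    exact not_lt.1 fun h => hi _ h rfl
  have hbad : ∃ᶠ i in atTop, ∃ t₁ t₂ : A.δ, ρ.trans i = t₁ ∧ A.α t₂ ≤ l' ∧
      t₁.1.1 = t₂.1.1 ∧ t₁.1.2.1 = t₂.1.2.1 ∧ t₁.1.2.2 ≠ t₂.1.2.2 := by
    obtain ⟨N, hN⟩ := eventually_atTop.1 hle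
    refine frequently_atTop.2 fun a => ?_
    obtain ⟨j, hj, hne⟩ := hρ (max a N)
    refine ⟨j, (le_max_left _ _).trans hj, ρ.trans j, ?_⟩
    by_contra hcon
    refine hne (Set.eq_singleton_iff_unique_mem.2 ⟨⟨⟨_, ρ.state_succ j, rfl⟩, ρ.state_succ j,
      hN j ((le_max_right _ _).trans hj)⟩, ?_⟩)
    rintro _ ⟨⟨u, hu, rfl⟩, hδ, hα⟩
    by_contra hu'
    refine hcon ⟨⟨_, hδ⟩, rfl, hα, rfl, rfl, fun h => hu' ?_⟩
    simp only [Run.trans] at h ⊢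
    rw [h]
  -- Pigeonhole: one transition occurs at infinitely many bad positions.
  obtain ⟨t₁, ht₁⟩ : ∃ t₁, ∃ᶠ i in atTop, ∃ t₂ : A.δ, ρ.trans i = t₁ ∧ A.α t₂ ≤ l' ∧
      t₁.1.1 = t₂.1.1 ∧ t₁.1.2.1 = t₂.1.2.1 ∧ t₁.1.2.2 ≠ t₂.1.2.2 := by
    by_contra hcon
    simp only [not_exists, not_frequently] at hcon
    refine hbad ((eventually_all.2 hcon).mono fun i hi => ?_)
    rintro ⟨t₁, t₂, h⟩
    exact hi t₁ t₂ h
  obtain ⟨N, hN⟩ := eventually_atTop.1 hle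
  -- Positions i < j < k with t₁ at i and k and priority `l'` at j, all beyond the point where
  -- higher priorities have died out.
  obtain ⟨i, hi, t₂, rfl, ht₂, hs, ha, ht⟩ := frequently_atTop.1 ht₁ N
  obtain ⟨j, hj, hjl⟩ := frequently_atTop.1 hl.1 (i + 1)
  obtain ⟨k, hk, _, hki, -⟩ := frequently_atTop.1 ht₁ (j + 1)
  replace hjl : A.α (ρ.trans j) = l' := hjl
  refine ⟨ρ.trans i, t₂, ρ.trans j, hjl ▸ heven, hjl ▸ hN i hi, hjl ▸ ht₂, hs, ha, ht, ?_, ?_, ?_⟩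
  · have := ρ.reflTransGen (fun _ => True) (Nat.zero_le i) fun _ _ => trivial
    rwa [ρ.state_zero] at this
  · exact ρ.reflTransGen _ hj fun n hn => hjl ▸ hN n (by omega)
  · have := ρ.reflTransGen (fun t => A.α t ≤ A.α (ρ.trans j)) hk fun n hn => hjl ▸ hN n (by omega)
    rw [show (ρ.trans i).1.1 = ρ.state k from congrArg (fun t : A.δ => t.1.1) hki.symm]
    exact this

/-- The transitions in the list `L` lead from `v` to `u`. -/
def IsWalk (v : V) : List A.δ → V → Prop
  | [], u => v = u
  | t :: L, u => t.1.1 = v ∧ IsWalk t.1.2.2 L u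

theorem IsWalk.append {v u x : V} {L L' : List A.δ} (h : IsWalk v L u) (h' : IsWalk u L' x) :
    IsWalk v (L ++ L') x := by
  induction L generalizing v with
  | nil => obtain rfl : v = u := h; exact h'
  | cons t L ih => exact ⟨h.1, ih h.2⟩

theorem exists_isWalk {p : A.δ → Prop} {v u : V} (h : ReflTransGen (A.Edge p) v u) :
    ∃ L : List A.δ, (∀ t ∈ L, p t) ∧ IsWalk v L u := by
  induction h using ReflTransGen.head_induction_on with
  | refl => exact ⟨[], by simp, rfl⟩
  | head h _ ih =>
    obtain ⟨t, ht, rfl, rfl⟩ := h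
    obtain ⟨L, hL, hw⟩ := ih
    exact ⟨t :: L, List.forall_mem_cons.2 ⟨ht, hL⟩, rfl, hw⟩

theorem IsWalk.target_getElem {v u : V} {L : List A.δ} (h : IsWalk v L u) (i : ℕ)
    (hi : i < L.length) :
    (∀ hi' : i + 1 < L.length, L[i].1.2.2 = L[i + 1].1.1) ∧ (i + 1 = L.length → L[i].1.2.2 = u) := by
  induction L generalizing v i with
  | nil => simp at hi
  | cons t L ih =>
    rcases i with _ | i
    · rcases L with _ | ⟨t', L⟩
      · exact ⟨by simp, fun _ => h.2⟩
      · exact ⟨fun _ => h.2.1.symm, by simp⟩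
    · have := ih h.2 i (by simpa using hi)
      simpa using this

/-- The sequence of transitions `s` is a path that begins in `v`. -/
def IsPath (v : V) (s : ℕ → A.δ) : Prop := (s 0).1.1 = v ∧ ∀ i, (s i).1.2.2 = (s (i + 1)).1.1

/-- The closed walk is traversed periodically, by indexing it modulo its length. -/
theorem IsWalk.exists_isPath {v : V} {t : A.δ} {L : List A.δ} (h : IsWalk v (t :: L) v) :
    ∃ s, IsPath v s ∧ (∀ i, s i ∈ t :: L) ∧ ∀ t' ∈ t :: L, ∃ᶠ i in atTop, s i = t' := by
  set M := t :: L with hM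
  have hn : 0 < M.length := by simp [hM]
  refine ⟨fun i => M[i % M.length]'(Nat.mod_lt _ hn), ⟨?_, fun i => ?_⟩, fun i => ?_, ?_⟩
  · simpa [hM] using h.1
  · have hi := Nat.mod_lt i hn
    obtain ⟨h₁, h₂⟩ := h.target_getElem _ hi
    by_cases hi' : i % M.length + 1 < M.length
    · have := h₁ hi'
      have hmod : (i + 1) % M.length = i % M.length + 1 := by
        rw [Nat.add_mod, Nat.mod_eq_of_lt (a := 1) (by omega), Nat.mod_eq_of_lt hi']
      simp only [hmod]
      exact this
    · have hmod : (i + 1) % M.length = 0 := by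
        rw [← Nat.mod_add_mod, show i % M.length + 1 = M.length by omega, Nat.mod_self]
      simp only [hmod]
      rw [h₂ (by omega)]
      exact h.1.symm
  · exact List.getElem_mem _
  · intro t' ht'
    obtain ⟨j, hj, rfl⟩ := List.mem_iff_getElem.1 ht'
    refine frequently_atTop.2 fun a => ⟨j + M.length * a, ?_, ?_⟩
    · nlinarith
    · simp only [Nat.add_mul_mod_self_left, Nat.mod_eq_of_lt hj]

theorem IsPath.cons {v : V} {t : A.δ} {s : ℕ → A.δ} (h : IsPath t.1.2.2 s) (ht : t.1.1 = v) :
    IsPath v (fun i => Nat.casesOn i t s) :=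
  ⟨ht, fun i => by cases i; exacts [h.1.symm, h.2 _]⟩

theorem exists_isPath_of_reflTransGen {p : A.δ → Prop} {v u : V} (h : ReflTransGen (A.Edge p) v u)
    {s : ℕ → A.δ} (hs : IsPath u s) : ∃ s' n, IsPath v s' ∧ ∀ i, s' (i + n) = s i := by
  induction h using ReflTransGen.head_induction_on with
  | refl => exact ⟨s, 0, hs, fun _ => rfl⟩
  | head h _ ih =>
    obtain ⟨t, ht, rfl, rfl⟩ := h
    obtain ⟨s', n, hs', h⟩ := ih
    exact ⟨_, n + 1, hs'.cons rfl, h⟩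

/-- The word along a path has the states of the path as a run. -/
def IsPath.run {v : V} {s : ℕ → A.δ} (h : IsPath v s) : A.Run v fun i => (s i).1.2.1 where
  state i := (s i).1.1
  state_zero := h.1
  state_succ i := by
    have : ((s i).1.1, (s i).1.2.1, (s (i + 1)).1.1) = (s i).1 := by rw [← h.2 i]
    exact this ▸ (s i).2

theorem IsPath.trans_run {v : V} {s : ℕ → A.δ} (h : IsPath v s) (i : ℕ) : h.run.trans i = s i := by
  refine Subtype.ext ?_
  simp only [Run.trans, IsPath.run, ← h.2 i]

/-- A path to the source of t₁ followed by endless repetition of the closed walk through t₁ and t₃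
is an accepting run. At every later visit to t₁, the transition t₂ is a second one of low enough
priority. -/
theorem HasViolation.not_limitDeterministic (h : A.HasViolation) : ¬ A.LimitDeterministic := by
  obtain ⟨t₁, t₂, t₃, heven, h₁, h₂, hs, ha, ht, hreach, h₁₃, h₃₁⟩ := h
  obtain ⟨L, hL, hw⟩ := exists_isWalk h₁₃
  obtain ⟨L', hL', hw'⟩ := exists_isWalk h₃₁
  have hcycle : IsWalk t₁.1.1 (t₁ :: (L ++ t₃ :: L')) t₁.1.1 := ⟨rfl, hw.append ⟨rfl, hw'⟩⟩
  have hle : ∀ t ∈ t₁ :: (L ++ t₃ :: L'), A.α t ≤ A.α t₃ := by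
    intro t ht
    simp only [List.mem_cons, List.mem_append] at ht
    rcases ht with rfl | ht | rfl | ht
    exacts [h₁, hL t ht, le_rfl, hL' t ht]
  obtain ⟨s, hs', hmem, hfreq⟩ := hcycle.exists_isPath
  obtain ⟨s', n, hs'', hn⟩ := exists_isPath_of_reflTransGen hreach hs'
  have hfreq' : ∀ t ∈ t₁ :: (L ++ t₃ :: L'), ∃ᶠ i in atTop, s' i = t := by
    intro t ht
    refine frequently_atTop.2 fun a => ?_
    obtain ⟨i, hi, h⟩ := frequently_atTop.1 (hfreq t ht) a
    exact ⟨i + n, by omega, (hn i).trans h⟩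
  have hmax : hs''.run.IsMaxInf (A.α t₃) := by
    constructor
    · exact (hfreq' t₃ (by simp)).mono fun i hi => by
        simp only [Function.comp_apply, hs''.trans_run, hi]
    · intro x hx
      obtain ⟨i, hi, rfl⟩ := frequently_atTop.1 hx n
      obtain ⟨j, rfl⟩ := Nat.exists_eq_add_of_le' hi
      simp only [Function.comp_apply, hs''.trans_run, hn]
      exact hle _ (hmem j)
  intro hLD
  obtain ⟨N, hN⟩ := hLD _ hs''.run ⟨_, hmax, heven⟩ _ hmax
  obtain ⟨j, hj, hj₁⟩ := frequently_atTop.1 (hfreq' t₁ (by simp)) N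
  have := hN j hj
  rw [hs''.trans_run, hj₁] at this
  have h₂mem : (t₂ : V × S × V) ∈ ({(t₁ : V × S × V)} : Set (V × S × V)) := by
    rw [← this]
    refine ⟨⟨t₂.1.2.2, ?_, ?_⟩, t₂.2, h₂⟩
    · simp only [IsPath.run, hj₁, hs, ha, succ]
      exact t₂.2
    · simp only [IsPath.run, hj₁, hs, ha]
  rw [Set.mem_singleton_iff] at h₂mem
  exact ht (by rw [h₂mem])

theorem limitDeterministic_iff [Finite A.δ] : A.LimitDeterministic ↔ ¬ A.HasViolation :=
  ⟨fun h h' => h'.not_limitDeterministic h, fun h => by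
    by_contra h'
    exact h (hasViolation_of_not_limitDeterministic h')⟩

end ParityAutomaton

/-! ### Correctness of the procedure on binary numbers -/

/-- The value of a binary number with the least significant bit first. -/
def binVal (a : List Bool) : ℕ := a.foldr (fun b n => b.toNat + 2 * n) 0

@[simp] theorem binVal_nil : binVal [] = 0 := rfl

@[simp] theorem binVal_cons (b : Bool) (a : List Bool) :
    binVal (b :: a) = b.toNat + 2 * binVal a := rfl

@[simp] theorem binVal_encodeNat (n : ℕ) : binVal (Computability.encodeNat n) = n := by
  have h : ∀ p : PosNum, binVal (Computability.encodePosNum p) = p := by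
    intro p
    induction p with
    | one => rfl
    | bit0 p ih => simp [Computability.encodePosNum, ih, PosNum.cast_bit0, two_mul]
    | bit1 p ih => simp [Computability.encodePosNum, ih, PosNum.cast_bit1]; ring
  conv_rhs => rw [← Num.to_of_nat n]
  unfold Computability.encodeNat
  cases (n : Num) with
  | zero => rfl
  | pos p => exact h p

theorem binLE_iff (a b : List Bool) : binLE a b = true ↔ binVal a ≤ binVal b := by
  have hany : ∀ b : List Bool, (b.any fun y => y) = true ↔ 0 < binVal b := by
    intro b
    induction b with
    | nil => simp
    | cons y b ih =>
      rw [List.any_cons, Bool.or_eq_true, ih]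
      cases y <;> simp
  -- The flag says how the less significant bits compare, so it decides only when the remaining
  -- numbers are equal. Missing bits of `b` count as zeros.
  have key : ∀ (a b : List Bool) (f : Bool),
      let s := a.foldl (fun (s : List Bool × Bool) x =>
        listElim s.1 ([], s.2 && !x) fun y ys => (ys, bif x then y && s.2 else y || s.2)) (b, f)
      (s.2 || s.1.any fun y => y) = true ↔
        binVal a < binVal b ∨ binVal a = binVal b ∧ f = true := by
    intro a
    induction a with
    | nil =>
      intro b f
      simp only [List.foldl_nil, Bool.or_eq_true, hany, binVal_nil]
      by_cases h : f = true
      · simp only [h, true_or, and_true, true_iff]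
        omega
      · simp [h]
    | cons x a ih =>
      intro b f
      rw [List.foldl_cons]
      refine (ih _ _).trans ?_
      rcases b with _ | ⟨y, b⟩
      · cases x <;> cases f <;> simp
      · cases x <;> cases y <;> cases f <;> simp <;> omega
  refine (key a b true).trans ?_
  simp only [and_true]
  omega

theorem binEq_iff (a b : List Bool) : binEq a b = true ↔ binVal a = binVal b := by
  rw [binEq, Bool.and_eq_true, binLE_iff, binLE_iff, le_antisymm_iff]

theorem binEven_iff (a : List Bool) : binEven a = true ↔ Even (binVal a) := by
  rcases a with _ | ⟨b, a⟩
  · simp [binEven]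
  · cases b <;> simp [binEven, Nat.even_add]

theorem binMem_iff (v : List Bool) (R : List (List Bool)) :
    binMem v R = true ↔ ∃ q ∈ R, binVal q = binVal v := by
  simp only [binMem, List.any_eq_true, binEq_iff]

theorem mem_transLE {T : List BinTrans} {l : List Bool} {t : BinTrans} :
    t ∈ transLE T l ↔ t ∈ T ∧ binVal t.2.2.2 ≤ binVal l := by
  have key : ∀ (T acc : List BinTrans),
      t ∈ T.foldl (fun acc t => bif binLE t.2.2.2 l then t :: acc else acc) acc ↔
        t ∈ acc ∨ t ∈ T ∧ binVal t.2.2.2 ≤ binVal l := by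
    intro T
    induction T with
    | nil => simp
    | cons s T ih =>
      intro acc
      rw [List.foldl_cons, ih]
      by_cases h : binLE s.2.2.2 l = true
      · rw [h, cond_true, List.mem_cons, List.mem_cons]
        rw [binLE_iff] at h
        aesop
      · rw [Bool.not_eq_true] at h
        rw [h, cond_false, List.mem_cons]
        have h' : ¬ binVal s.2.2.2 ≤ binVal l := by
          rw [← binLE_iff, h]; simp
        refine or_congr_right ⟨fun h => ⟨.inr h.1, h.2⟩, ?_⟩
        rintro ⟨rfl | h₁, h₂⟩
        exacts [absurd h₂ h', ⟨h₁, h₂⟩]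
  refine (key T []).trans ?_
  simp

/-- Some transition in `E` leads from `x` to `y`. -/
def BinEdge (E : List BinTrans) (x y : ℕ) : Prop :=
  ∃ t ∈ E, binVal t.1 = x ∧ binVal t.2.2.1 = y

theorem exists_mem_reachStep {E : List BinTrans} {R₀ R : List (List Bool)} {x : ℕ} :
    (∃ q ∈ reachStep E R₀ R, binVal q = x) ↔
      (∃ q ∈ R₀, binVal q = x) ∨ ∃ q ∈ R, BinEdge E (binVal q) x := by
  unfold reachStep
  induction E generalizing R₀ with
  | nil => simp [BinEdge]
  | cons t E ih =>
    rw [List.foldl_cons, ih]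
    have hE : ∀ y, BinEdge (t :: E) y x ↔
        (binVal t.1 = y ∧ binVal t.2.2.1 = x) ∨ BinEdge E y x := by
      intro y
      simp only [BinEdge, List.mem_cons, exists_eq_or_imp]
    simp only [hE]
    by_cases h : (R.any fun q => binEq q t.1) = true
    · rw [h, cond_true]
      simp only [List.any_eq_true, binEq_iff] at h
      obtain ⟨q, hq, hqt⟩ := h
      simp only [List.mem_cons, exists_eq_or_imp]
      constructor
      · rintro ((h | h) | ⟨q', hq', h⟩)
        exacts [.inr ⟨q, hq, .inl ⟨hqt.symm, h⟩⟩, .inl h, .inr ⟨q', hq', .inr h⟩]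
      · rintro (h | ⟨q', hq', h | h⟩)
        exacts [.inl (.inr h), .inl (.inl h.2), .inr ⟨q', hq', h⟩]
    · rw [Bool.not_eq_true] at h
      rw [h, cond_false]
      rw [List.any_eq_false] at h
      simp only [binEq_iff] at h
      constructor
      · rintro (h | ⟨q', hq', h⟩)
        exacts [.inl h, .inr ⟨q', hq', .inr h⟩]
      · rintro (h' | ⟨q', hq', h' | h'⟩)
        exacts [.inl h', absurd h'.1.symm (h q' hq'), .inr ⟨q', hq', h'⟩]

open Relation in
-- Let `N k` be the set of states listed after k steps and `C k` the set of transitions with target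
-- in `N k`. As long as `N k` is not closed under edges, `C k` grows strictly. Since `C k` has at
-- most `E.length` elements, `N E.length` is closed.
theorem exists_mem_reach {E : List BinTrans} {u : List Bool} {x : ℕ} :
    (∃ q ∈ reach E u, binVal q = x) ↔ ReflTransGen (BinEdge E) (binVal u) x := by
  classical
  let N : ℕ → Set ℕ := fun k => {x | ∃ q ∈ (reachStep E [u])^[k] [u], binVal q = x}
  have hreach : reach E u = (reachStep E [u])^[E.length] [u] := by
    unfold reach
    rw [List.foldl_const]
  have hN0 : ∀ x, x ∈ N 0 ↔ x = binVal u := fun x => by simp [N, eq_comm]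
  have hN : ∀ k x, x ∈ N (k + 1) ↔ x = binVal u ∨ ∃ y ∈ N k, BinEdge E y x := by
    intro k x
    change (∃ q ∈ (reachStep E [u])^[k + 1] [u], binVal q = x) ↔ _
    rw [Function.iterate_succ_apply', exists_mem_reachStep]
    simp [N, eq_comm]
  have hu : ∀ k, binVal u ∈ N k := by
    rintro (_ | k)
    · rw [hN0]
    · exact (hN k _).2 (.inl rfl)
  -- Not immediate, since every step restarts from `[u]`; it follows by induction from monotonicity
  -- of the step.
  have hmono : ∀ k, N k ⊆ N (k + 1) := by
    intro k
    induction k with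
    | zero =>
      intro x hx
      rw [(hN0 x).1 hx]
      exact hu 1
    | succ k ih =>
      intro x hx
      rw [hN] at hx ⊢
      exact hx.imp_right fun ⟨y, hy, h⟩ => ⟨y, ih hy, h⟩
  let C : ℕ → Finset BinTrans := fun k => E.toFinset.filter fun t => binVal t.2.2.1 ∈ N k
  have hC : ∀ k, C k ⊆ C (k + 1) := fun k t ht => by
    simp only [C, Finset.mem_filter] at ht ⊢
    exact ⟨ht.1, hmono k ht.2⟩
  have hstep : ∀ k, (∀ y ∈ N k, ∀ x, BinEdge E y x → x ∈ N k) ∨ (C k).card < (C (k + 1)).card := by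
    intro k
    by_contra! h
    obtain ⟨⟨y, hy, x, hyx, hx⟩, hcard⟩ := h
    have heq := Finset.eq_of_subset_of_card_le (hC k) hcard
    obtain ⟨t, ht, rfl, rfl⟩ := hyx
    have : t ∈ C (k + 1) := by
      simp only [C, Finset.mem_filter, List.mem_toFinset]
      exact ⟨ht, (hN k _).2 (.inr ⟨_, hy, t, ht, rfl, rfl⟩)⟩
    rw [← heq] at this
    exact hx (Finset.mem_filter.1 this).2
  have hclosed : ∀ k, (∀ y ∈ N k, ∀ x, BinEdge E y x → x ∈ N k) ∨ k + 1 ≤ (C (k + 1)).card := by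
    intro k
    induction k with
    | zero => exact (hstep 0).imp_right fun h => by omega
    | succ k ih =>
      rcases hstep (k + 1) with h | h
      · exact .inl h
      · rcases ih with hcl | hcard
        · refine .inl fun y hy x hyx => (hN k x).2 (.inr ⟨y, ?_, hyx⟩)
          rcases (hN k y).1 hy with rfl | ⟨z, hz, hzy⟩
          exacts [hu k, hcl z hz y hzy]
        · exact .inr (by omega)
  have hfinal : ∀ y ∈ N E.length, ∀ x, BinEdge E y x → x ∈ N E.length := by
    refine (hclosed E.length).resolve_right fun h => ?_
    have h₁ : (C (E.length + 1)).card ≤ E.toFinset.card :=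
      Finset.card_le_card (Finset.filter_subset _ _)
    have h₂ := E.toFinset_card_le
    omega
  rw [hreach]
  change x ∈ N E.length ↔ _
  constructor
  · suffices ∀ k x, x ∈ N k → ReflTransGen (BinEdge E) (binVal u) x from this _ x
    intro k
    induction k with
    | zero => intro x hx; rw [(hN0 x).1 hx]
    | succ k ih =>
      intro x hx
      rcases (hN k x).1 hx with rfl | ⟨y, hy, h⟩
      exacts [.refl, (ih y hy).tail h]
  · intro h
    induction h with
    | refl => exact hu _
    | tail _ h ih => exact hfinal _ ih _ h

open Relation in
theorem noViolation_iff {T : List BinTrans} {u : List Bool} :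
    noViolation T u = true ↔ ¬ ∃ t₁ ∈ T, ∃ t₂ ∈ T, ∃ t₃ ∈ T,
      Even (binVal t₃.2.2.2) ∧ binVal t₁.2.2.2 ≤ binVal t₃.2.2.2 ∧
      binVal t₂.2.2.2 ≤ binVal t₃.2.2.2 ∧ binVal t₁.1 = binVal t₂.1 ∧
      binVal t₁.2.1 = binVal t₂.2.1 ∧ binVal t₁.2.2.1 ≠ binVal t₂.2.2.1 ∧
      ReflTransGen (BinEdge T) (binVal u) (binVal t₁.1) ∧
      ReflTransGen (BinEdge (transLE T t₃.2.2.2)) (binVal t₁.2.2.1) (binVal t₃.1) ∧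
      ReflTransGen (BinEdge (transLE T t₃.2.2.2)) (binVal t₃.2.2.1) (binVal t₁.1) := by
  have hne : ∀ a b : List Bool, (!binEq a b) = true ↔ binVal a ≠ binVal b := fun a b => by
    rw [Bool.not_eq_true', ← Bool.not_eq_true, binEq_iff]
  unfold noViolation
  rw [Bool.not_eq_true', ← Bool.not_eq_true]
  simp only [List.any_eq_true, isViolation, Bool.and_eq_true, binEven_iff, binLE_iff, binEq_iff,
    hne, binMem_iff, exists_mem_reach, and_assoc]

/-- Read from the right, a comma opens an empty number, and the bits before it are then put in
front, most significant first. -/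
theorem parseNumbers_encodeNumbers (l : List ℕ) :
    parseNumbers ((encodeNumbers l).map Prog.token) = l.map Computability.encodeNat := by
  unfold parseNumbers
  rw [List.foldl_reverse]
  induction l with
  | nil => rfl
  | cons x l ih =>
    have h : (encodeNumbers (x :: l)).map Prog.token =
        (Computability.encodeNat x).map (fun b => [b]) ++
          [] :: (encodeNumbers l).map Prog.token := by
      simp [encodeNumbers, Prog.token, Function.comp_def]
    rw [h, List.foldr_append, List.foldr_cons, ih, listElim_nil, List.map_cons]
    generalize Computability.encodeNat x = a
    induction a with
    | nil => rfl
    | cons b a ih => rw [List.map_cons, List.foldr_cons, ih]; rfl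

theorem parseTrans_flatMap {X : Type*} (l : List X) (a b c d : X → List Bool) :
    parseTrans (l.flatMap fun x => [a x, b x, c x, d x]) =
      (l.map fun x => (a x, b x, c x, d x)).reverse := by
  have key : ∀ (l : List X) (out : List BinTrans),
      (l.flatMap fun x => [a x, b x, c x, d x]).foldl
        (fun (s : List (List Bool) × List BinTrans) d =>
          listElim s.1 ([d], s.2) fun c s₁ => listElim s₁ ([d, c], s.2) fun b s₂ =>
          listElim s₂ ([d, c, b], s.2) fun a _ => ([], (a, b, c, d) :: s.2)) ([], out) =
      ([], (l.map fun x => (a x, b x, c x, d x)).reverse ++ out) := by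
    intro l
    induction l with
    | nil => intro out; rfl
    | cons x l ih =>
      intro out
      rw [List.flatMap_cons, List.foldl_append]
      refine (ih _).trans ?_
      simp
  unfold parseTrans
  rw [key, List.append_nil]

/-- A chain that starts in the range of `f` stays there, and injectivity lets the preimages of
consecutive edges be joined. -/
theorem Relation.reflTransGen_map_iff {X Y : Type*} {r : X → X → Prop} {f : X → Y}
    (hf : Function.Injective f) {x y : X} :
    ReflTransGen (Relation.Map r f f) (f x) (f y) ↔ ReflTransGen r x y := by
  refine ⟨fun h => ?_, fun h => h.lift f fun a b hab => ⟨a, b, hab, rfl, rfl⟩⟩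
  obtain ⟨z, hz, h⟩ : ∃ z, f z = f y ∧ ReflTransGen r x z := by
    generalize f y = w at h
    induction h with
    | refl => exact ⟨x, rfl, .refl⟩
    | tail _ h ih =>
      obtain ⟨z, rfl, hz⟩ := ih
      obtain ⟨a, b, hab, ha, rfl⟩ := h
      obtain rfl := hf ha
      exact ⟨b, rfl, hz.tail hab⟩
  exact hf hz ▸ h

/-! ### Correctness of the procedure on presented automata -/

namespace PresentedParityAutomaton

/-- A transition with its components in binary. -/
def binTrans (P : PresentedParityAutomaton) (t : P.toAutomaton.δ) : BinTrans :=
  (Computability.encodeNat t.1.1, Computability.encodeNat t.1.2.1,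
    Computability.encodeNat t.1.2.2, Computability.encodeNat (P.toAutomaton.α t))

theorem checkLimitDeterministic_encode (P : PresentedParityAutomaton) :
    checkLimitDeterministic (P.encode.map Prog.token) =
      noViolation (P.transitions.map P.binTrans).reverse
        (Computability.encodeNat P.toAutomaton.u₀) := by
  unfold checkLimitDeterministic encode
  rw [parseNumbers_encodeNumbers]
  simp only [numbers, List.map_cons, List.map_nil, List.cons_append,
    List.nil_append, listElim_cons, List.map_flatMap]
  rw [parseTrans_flatMap]
  rfl

theorem binEdge_eq_map (P : PresentedParityAutomaton) {E : List BinTrans}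
    {p : P.toAutomaton.δ → Prop} (hE : ∀ t, t ∈ E ↔ ∃ s, p s ∧ P.binTrans s = t) :
    BinEdge E = Relation.Map (P.toAutomaton.Edge p) Fin.val Fin.val := by
  funext x y
  refine propext ⟨?_, ?_⟩
  · rintro ⟨t, ht, rfl, rfl⟩
    obtain ⟨s, hs, rfl⟩ := (hE t).1 ht
    exact ⟨_, _, ⟨s, hs, rfl, rfl⟩, by simp [binTrans], by simp [binTrans]⟩
  · rintro ⟨_, _, ⟨s, hs, rfl, rfl⟩, rfl, rfl⟩
    exact ⟨_, (hE _).2 ⟨s, hs, rfl⟩, by simp [binTrans], by simp [binTrans]⟩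

theorem checkLimitDeterministic_iff (P : PresentedParityAutomaton) :
    checkLimitDeterministic (P.encode.map Prog.token) = true ↔
      P.toAutomaton.LimitDeterministic := by
  -- The conjunct `True` gives the form required by `binEdge_eq_map`, for the edge relation without
  -- a bound on priorities.
  have hmem : ∀ t, t ∈ (P.transitions.map P.binTrans).reverse ↔
      ∃ s, True ∧ P.binTrans s = t := fun t => by
    simp only [List.mem_reverse, List.mem_map, P.complete, true_and]
  have hmemLE : ∀ s₃ t, t ∈ transLE (P.transitions.map P.binTrans).reverse (P.binTrans s₃).2.2.2 ↔
      ∃ s, P.toAutomaton.α s ≤ P.toAutomaton.α s₃ ∧ P.binTrans s = t := fun s₃ t => by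
    rw [mem_transLE, hmem]
    constructor
    · rintro ⟨⟨s, -, rfl⟩, h⟩
      exact ⟨s, by simpa [binTrans] using h, rfl⟩
    · rintro ⟨s, h, rfl⟩
      exact ⟨⟨s, trivial, rfl⟩, by simpa [binTrans] using h⟩
  rw [checkLimitDeterministic_encode, noViolation_iff, ParityAutomaton.limitDeterministic_iff,
    P.binEdge_eq_map hmem]
  refine not_congr ?_
  have hex : ∀ q : BinTrans → Prop,
      (∃ t ∈ (P.transitions.map P.binTrans).reverse, q t) ↔ ∃ s, q (P.binTrans s) := fun q => by
    simp only [hmem, true_and]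
    exact ⟨fun ⟨_, ⟨s, rfl⟩, h⟩ => ⟨s, h⟩, fun ⟨s, h⟩ => ⟨_, ⟨s, rfl⟩, h⟩⟩
  simp only [hex, P.binEdge_eq_map (hmemLE _)]
  simp only [binTrans, binVal_encodeNat, ParityAutomaton.HasViolation,
    Relation.reflTransGen_map_iff Fin.val_injective, Fin.val_inj, ne_eq]

end PresentedParityAutomaton

theorem mainTheorem5 :
    DecidableInPolyTime PresentedParityAutomaton.encode
      (fun P => P.toAutomaton.LimitDeterministic) :=
  PolyTime.checkLimitDeterministic.decidableInPolyTime
    PresentedParityAutomaton.checkLimitDeterministic_iff
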